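/- Theorem 1. Let $0<p<1$, $0<q<1$ and let $d\ge 2$ be an integer. Time is slotted. Channel 1 is a two-state Markov chain $l_1(t)\in\{0,1\}$ ($1$ = ON, $0$ = OFF) that stays ON with probability $q$ and stays OFF with probability $p$; a packet sent over it in slot $t$ takes one slot and is delivered if and only if $l_1(t)=1$. Channel 2 is reliable and takes $d$ slots per packet; $l_2(t)\in\{0,\dots,d-1\}$ is its remaining transmission time in slot $t$, and $l_2(t)=0$ means that it is idle. In slot $t$ the scheduler takes a decision $u(t)\in\{1,2,\mathrm{none}\}$: send a fresh packet over Channel 1 or over Channel 2, or send nothing. The state is $(\Delta(t),l_1(t-1),l_2(t))\in\{1,2,\dots\}\times\{0,1\}\times\{0,\dots,d-1\}$. If $l_2(t)=0$ and $u(t)=2$, then $l_2(t+1)=d-1$; if $l_2(t)\ge1$, then $l_2(t+1)=l_2(t)-1$; otherwise $l_2(t+1)=0$. The age satisfies $\Delta(t+1)=1$ if $l_2(t)=0$, $u(t)=1$ and $l_1(t)=1$; $\Delta(t+1)=d$ if $l_2(t)=1$; and $\Delta(t+1)=\Delta(t)+1$ otherwise. A policy $\pi$ is admissible if $u(t)$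 depends only on the states up to slot $t$ and on the earlier decisions (possibly with randomization), and $u(t)=\mathrm{none}$ whenever $l_2(t)\ge 1$. For a given initial state $s(0)=s_0$ consider the problem $$\bar\Delta_{\mathrm{opt}}(s_0)=\inf_{\pi\ \text{admissible}}\ \limsup_{T\to\infty}\frac1T\sum_{t=1}^{T}\mathbb E\big[\Delta_\pi(t)\,\big|\,s(0)=s_0\big].$$ For a deterministic stationary policy $\mu(\delta,l_1,l_2)$ and a fixed $l_1\in\{0,1\}$, say that $\mu(\delta,l_1,0)$ is non-decreasing in the age $\delta$ if there is a threshold $\lambda\in\{0,1,2,\dots\}\cup\{\infty\}$ such that, for all integers $\delta\ge1$, $\mu(\delta,l_1,0)=1$ if $\delta<\lambda$ and $\mu(\delta,l_1,0)=2$ if $\delta\ge\lambda$; say that it is non-increasing in $\delta$ if the same holds with the actions $1$ and $2$ exchanged. Put $$F=\frac1{1-p}-d,\qquad G=1-dq,\qquad H=\frac{1-q}{1-p}-d+1,$$ and let $\mathbf B_1=\{F\le0,\,H\le0\}$, $\mathbf B_2=\{F>0,\,G\le0\}$, $\mathbf B_3=\{F>0,\,G>0\}$, $\mathbf B_4=\{F\le0,\,H>0\}$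 be the corresponding sets of parameters $(p,q,d)$. Then there is an admissible deterministic stationary policy $\mu^*$ that attains $\bar\Delta_{\mathrm{opt}}(s_0)$ for every initial state $s_0$ and has the following properties: (a) if $(p,q,d)\in\mathbf B_1$, then $\mu^*(\delta,0,0)$ and $\mu^*(\delta,1,0)$ are both non-increasing in $\delta$; (b) if $(p,q,d)\in\mathbf B_2$, then $\mu^*(\delta,0,0)$ is non-decreasing and $\mu^*(\delta,1,0)$ is non-increasing in $\delta$; (c) if $(p,q,d)\in\mathbf B_3$, then $\mu^*(\delta,0,0)$ and $\mu^*(\delta,1,0)$ are both non-decreasing in $\delta$; (d) if $(p,q,d)\in\mathbf B_4$, then $\mu^*(\delta,0,0)$ is non-increasing and $\mu^*(\delta,1,0)$ is non-decreasing in $\delta$. -/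

import Mathlib

open scoped ENNReal

noncomputable section

namespace HeteroAoI

/-- The channel parameters `(p, q, d)`: `p` and `q` are the self-transition probabilities of the
OFF and of the ON state of Channel 1, and `d` is the transmission time (in slots) of Channel 2. -/
structure Params where
  p : ℝ
  q : ℝ
  d : ℕ
  p_pos : 0 < p
  p_lt_one : p < 1
  q_pos : 0 < q
  q_lt_one : q < 1
  two_le_d : 2 ≤ d

/-- Scheduling decisions: send a fresh packet on Channel 1, on Channel 2, or send nothing. -/
inductive Action where
  | ch1
  | ch2
  | none

/-- The state `(Δ(t), l₁(t-1), l₂(t))`: the age, the state of Channel 1 in the previous slot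
(`true` is ON, i.e. `1`; `false` is OFF, i.e. `0`), and the remaining transmission time on
Channel 2 (`0` is idle). The state space is the set `states θ` below. -/
structure State where
  age : ℕ
  l1 : Bool
  l2 : ℕ

/-- The state space `{1, 2, …} × {0, 1} × {0, …, d - 1}`. It is closed under the transitions. -/
def states (θ : Params) : Set State := {s | 1 ≤ s.age ∧ s.l2 < θ.d}

/-- The probability that Channel 1 is ON in a slot, given its state in the previous slot. -/
def onProb (θ : Params) (l1 : Bool) : ℝ := if l1 then θ.q else 1 - θ.p

theorem onProb_nonneg (θ : Params) (l1 : Bool) : 0 ≤ onProb θ l1 := by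
  have h1 := θ.p_lt_one
  have h2 := θ.q_pos
  cases l1 <;> simp [onProb] <;> linarith

theorem onProb_le_one (θ : Params) (l1 : Bool) : onProb θ l1 ≤ 1 := by
  have h1 := θ.p_pos
  have h2 := θ.q_lt_one
  cases l1 <;> simp [onProb] <;> linarith

/-- The law of the state of Channel 1 in a slot, given its state `l1` in the previous slot. -/
def channelLaw (θ : Params) (l1 : Bool) : PMF Bool :=
  PMF.ofFintype
    (fun b => if b then ENNReal.ofReal (onProb θ l1) else ENNReal.ofReal (1 - onProb θ l1))
    (by
      rw [Fintype.sum_bool]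
      simp only [if_true, Bool.false_eq_true, if_false]
      rw [← ENNReal.ofReal_add (onProb_nonneg θ l1) (sub_nonneg.2 (onProb_le_one θ l1))]
      simp)

/-- The state in slot `t + 1`, given the state and the decision in slot `t` and the state `b` of
Channel 1 in slot `t`. While Channel 2 is busy the decision is irrelevant (admissible policies
then choose `none`). -/
def nextState (θ : Params) (s : State) (u : Action) (b : Bool) : State :=
  match s.l2, u with
  | 0, Action.ch1 => if b then ⟨1, b, 0⟩ else ⟨s.age + 1, b, 0⟩
  | 0, Action.ch2 => ⟨s.age + 1, b, θ.d - 1⟩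
  | 0, Action.none => ⟨s.age + 1, b, 0⟩
  | 1, _ => ⟨θ.d, b, 0⟩
  | k + 2, _ => ⟨s.age + 1, b, k + 1⟩

/-- The transition law `P_{s s'}(u)` of the Markov decision process. -/
def transition (θ : Params) (s : State) (u : Action) : PMF State :=
  (channelLaw θ s.l1).map (nextState θ s u)

/-- What the scheduler knows in slot `t`: the past `(s(t-1), u(t-1)), …, (s(0), u(0))`, most
recent slot first, together with the current state `s(t)`. -/
abbrev History := List (State × Action) × State

/-- A scheduling policy: the decision in each slot depends on the whole history (it may also be
randomized; deterministic decisions are the point masses). The slot `t` is the length of the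
past. -/
abbrev Policy := History → PMF Action

/-- A policy is admissible if it sends nothing while Channel 2 is busy. -/
def Admissible (π : Policy) : Prop :=
  ∀ h : History, 1 ≤ h.2.l2 → π h = PMF.pure Action.none

/-- The law of the history up to slot `t` under the policy `π`, started in the state `s₀`. -/
def historyLaw (θ : Params) (π : Policy) (s₀ : State) : ℕ → PMF History
  | 0 => PMF.pure ([], s₀)
  | t + 1 => (historyLaw θ π s₀ t).bind fun h =>
      (π h).bind fun u => (transition θ h.2 u).map fun s' => ((h.2, u) :: h.1, s')

/-- The expected age `𝔼[Δ_π(t)]`, given `s(0) = s₀`. -/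
def expectedAge (θ : Params) (π : Policy) (s₀ : State) (t : ℕ) : ℝ≥0∞ :=
  ∑' h : History, historyLaw θ π s₀ t h * (h.2.age : ℝ≥0∞)

/-- The expected time-average age `limsup_T (1/T) ∑_{t=1}^T 𝔼[Δ_π(t)]`, given `s(0) = s₀`. -/
def averageAge (θ : Params) (π : Policy) (s₀ : State) : ℝ≥0∞ :=
  Filter.limsup (fun T : ℕ => (∑ t ∈ Finset.Icc 1 T, expectedAge θ π s₀ t) / (T : ℝ≥0∞))
    Filter.atTop

/-- The optimal average age: the infimum over all admissible policies. -/
def optimalAge (θ : Params) (s₀ : State) : ℝ≥0∞ :=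
  ⨅ π : Policy, ⨅ _ : Admissible π, averageAge θ π s₀

/-- A deterministic stationary policy `μ(δ, l₁, l₂)`, as a policy. -/
def stationary (μ : State → Action) : Policy := fun h => PMF.pure (μ h.2)

/-- The deterministic stationary policy `μ` solves the average-age problem: it is admissible and,
from every initial state, its average age is the least one among all admissible policies. -/
def IsOptimal (θ : Params) (μ : State → Action) : Prop :=
  Admissible (stationary μ) ∧
    ∀ s₀ ∈ states θ, averageAge θ (stationary μ) s₀ = optimalAge θ s₀

/-- `μ(δ, l₁, 0)` is non-decreasing in the age: Channel 1 below a threshold, Channel 2 from it on.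
The threshold `⊤` gives the constant policy. -/
def NonDecreasingInAge (μ : State → Action) (l1 : Bool) : Prop :=
  ∃ lam : ℕ∞, ∀ δ : ℕ, 1 ≤ δ →
    ((δ : ℕ∞) < lam → μ ⟨δ, l1, 0⟩ = Action.ch1) ∧
    (lam ≤ (δ : ℕ∞) → μ ⟨δ, l1, 0⟩ = Action.ch2)

/-- `μ(δ, l₁, 0)` is non-increasing in the age: Channel 2 below a threshold, Channel 1 from it on.
The threshold `⊤` gives the constant policy. -/
def NonIncreasingInAge (μ : State → Action) (l1 : Bool) : Prop :=
  ∃ lam : ℕ∞, ∀ δ : ℕ, 1 ≤ δ →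
    ((δ : ℕ∞) < lam → μ ⟨δ, l1, 0⟩ = Action.ch2) ∧
    (lam ≤ (δ : ℕ∞) → μ ⟨δ, l1, 0⟩ = Action.ch1)

def F (θ : Params) : ℝ := 1 / (1 - θ.p) - θ.d

def G (θ : Params) : ℝ := 1 - θ.d * θ.q

def H (θ : Params) : ℝ := (1 - θ.q) / (1 - θ.p) - θ.d + 1

def B₁ : Set Params := {θ | F θ ≤ 0 ∧ H θ ≤ 0}

def B₂ : Set Params := {θ | 0 < F θ ∧ G θ ≤ 0}

def B₃ : Set Params := {θ | 0 < F θ ∧ 0 < G θ}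

def B₄ : Set Params := {θ | F θ ≤ 0 ∧ 0 < H θ}

end HeteroAoI

end

open scoped ENNReal

noncomputable section

namespace HeteroAoI

/-! ### Expectations of extended nonnegative functions under a probability mass function -/

/-! The average-cost optimality equation is solved by vanishing discount, and the thresholds are
read off its solution. Discounted value iteration yields gains `g` and relative values `h`,
normalized at (1, ON, idle), with bounds that do not depend on the discount factor; compactness
gives a limit at discount factor 1 (`exists_relativeValue`). Sending nothing is left out of the
equation: by monotonicity in the age it never beats Channel 1 (`subsolution`).

In an idle state, Channel 1 costs δ - g + P(OFF) h(δ+1, OFF) and Channel 2 an affine function of δ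
with slope d. With m = 1/(1-p), the increments of `h` along the OFF states lie between min(d, m) and
max(d, m) (`min_le_growth`, `growth_le`). Inserted into the increments of `ch1Excess`, these bounds
bring out the signs of F, G and H. This settles the OFF states everywhere and the ON states in B₃
and B₄.

For the ON states in B₁ and B₂ these bounds need not make the excess decreasing. However, a policy
that always transmits when idle enters idle ON states only at age 1 (delivery by Channel 1) or d
(delivery by Channel 2), so it has to be greedy only there. The policy is taken constant on the ages
below d and on the ages from d on, and it remains to see that Channel 1 is optimal at (d, ON).
Otherwise the gain would be close to (3d-1)/2, that of Channel 2 alone (`of_excess_on_pos`), which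
contradicts the relations that Channel 1 imposes on `g` and `h`.

Optimality is verified with two functions: `h` is a subsolution and bounds all policies from below,
while the one-step lookahead of `h` under the policy is a supersolution, because the policy is
greedy in every state it enters. -/

/-- The expectation of `f` under `p`. -/
def pmfMean {X : Type*} (p : PMF X) (f : X → ℝ≥0∞) : ℝ≥0∞ := ∑' x, p x * f x

section pmfMean

variable {X Y : Type*}

theorem pmfMean_pure (a : X) (f : X → ℝ≥0∞) : pmfMean (PMF.pure a) f = f a := by
  unfold pmfMean
  rw [tsum_eq_single a]
  · simp
  · intro b hb
    simp [PMF.pure_apply, hb]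

theorem pmfMean_bind (p : PMF X) (k : X → PMF Y) (f : Y → ℝ≥0∞) :
    pmfMean (p.bind k) f = pmfMean p fun x => pmfMean (k x) f := by
  unfold pmfMean
  simp only [PMF.bind_apply, ← ENNReal.tsum_mul_right, ← ENNReal.tsum_mul_left]
  rw [ENNReal.tsum_comm]
  simp only [mul_assoc]

theorem pmfMean_map (p : PMF X) (k : X → Y) (f : Y → ℝ≥0∞) :
    pmfMean (p.map k) f = pmfMean p fun x => f (k x) := by
  unfold PMF.map
  rw [pmfMean_bind]
  simp [pmfMean_pure]

theorem pmfMean_mono {p : PMF X} {f g : X → ℝ≥0∞} (h : ∀ x ∈ p.support, f x ≤ g x) :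
    pmfMean p f ≤ pmfMean p g := by
  refine ENNReal.tsum_le_tsum fun x => ?_
  by_cases hx : p x = 0
  · simp [hx]
  · exact mul_le_mul_right (h x ((p.mem_support_iff x).2 hx)) _

theorem pmfMean_const (p : PMF X) (c : ℝ≥0∞) : pmfMean p (fun _ => c) = c := by
  unfold pmfMean
  rw [ENNReal.tsum_mul_right, p.tsum_coe, one_mul]

theorem pmfMean_add (p : PMF X) (f g : X → ℝ≥0∞) :
    pmfMean p (fun x => f x + g x) = pmfMean p f + pmfMean p g := by
  unfold pmfMean
  simp only [mul_add]
  exact ENNReal.tsum_add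

theorem pmfMean_const_mul (p : PMF X) (c : ℝ≥0∞) (f : X → ℝ≥0∞) :
    pmfMean p (fun x => c * f x) = c * pmfMean p f := by
  unfold pmfMean
  rw [← ENNReal.tsum_mul_left]
  exact tsum_congr fun x => by ring

end pmfMean

/-! ### The controlled chain -/

/-- The real expectation of `h` at the next state. -/
def nextMean (θ : Params) (h : State → ℝ) (s : State) (u : Action) : ℝ :=
  onProb θ s.l1 * h (nextState θ s u true) + (1 - onProb θ s.l1) * h (nextState θ s u false)

theorem nextState_mem_states (θ : Params) {s : State} (hs : s ∈ states θ) (u : Action)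
    (b : Bool) : nextState θ s u b ∈ states θ := by
  obtain ⟨δ, l, k⟩ := s
  have hd := θ.two_le_d
  simp only [states, Set.mem_ofPred_eq] at hs ⊢
  obtain ⟨h1, h2⟩ := hs
  rcases k with _ | _ | k
  · cases u <;> cases b <;> simp [nextState] <;> omega
  · cases u <;> simp [nextState] <;> omega
  · cases u <;> simp [nextState] <;> omega

theorem pmfMean_transition (θ : Params) {h : State → ℝ} {s : State} {u : Action}
    (h0 : ∀ b, 0 ≤ h (nextState θ s u b)) :
    pmfMean (transition θ s u) (fun s' => ENNReal.ofReal (h s')) =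
      ENNReal.ofReal (nextMean θ h s u) := by
  have h1 := onProb_nonneg θ s.l1
  have h2 := sub_nonneg.2 (onProb_le_one θ s.l1)
  unfold transition
  rw [pmfMean_map, pmfMean, tsum_fintype, Fintype.sum_bool, nextMean,
    ENNReal.ofReal_add (mul_nonneg h1 (h0 _)) (mul_nonneg h2 (h0 _)),
    ENNReal.ofReal_mul h1, ENNReal.ofReal_mul h2]
  simp [channelLaw]

theorem mem_states_of_mem_support_historyLaw (θ : Params) (π : Policy) {s₀ : State}
    (hs₀ : s₀ ∈ states θ) (t : ℕ) :
    ∀ h ∈ (historyLaw θ π s₀ t).support, h.2 ∈ states θ := by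
  induction t with
  | zero =>
    intro h hh
    simp only [historyLaw, PMF.support_pure, Set.mem_singleton_iff] at hh
    simpa [hh] using hs₀
  | succ t ih =>
    intro h hh
    simp only [historyLaw, transition, PMF.mem_support_bind_iff, PMF.mem_support_map_iff] at hh
    obtain ⟨h', hh', u, -, s', ⟨b, -, rfl⟩, rfl⟩ := hh
    exact nextState_mem_states θ (ih h' hh') u b

/-- The expectation of a function of the state in slot `t`. -/
def stateMean (θ : Params) (π : Policy) (s₀ : State) (t : ℕ) (f : State → ℝ≥0∞) : ℝ≥0∞ :=
  pmfMean (historyLaw θ π s₀ t) fun h => f h.2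

theorem expectedAge_eq_stateMean (θ : Params) (π : Policy) (s₀ : State) (t : ℕ) :
    expectedAge θ π s₀ t = stateMean θ π s₀ t fun s => (s.age : ℝ≥0∞) := rfl

theorem stateMean_zero (θ : Params) (π : Policy) (s₀ : State) (f : State → ℝ≥0∞) :
    stateMean θ π s₀ 0 f = f s₀ := by
  simp [stateMean, historyLaw, pmfMean_pure]

theorem stateMean_succ (θ : Params) (π : Policy) (s₀ : State) (t : ℕ) (f : State → ℝ≥0∞) :
    stateMean θ π s₀ (t + 1) f = pmfMean (historyLaw θ π s₀ t) fun h =>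
      pmfMean (π h) fun u => pmfMean (transition θ h.2 u) f := by
  simp [stateMean, historyLaw, pmfMean_bind, pmfMean_map]

/-! ### Verification -/

/-- A nonnegative subsolution of the average-cost equation bounds the accumulated age from
below. -/
theorem subsolution_bound (θ : Params) (π : Policy) {s₀ : State} (hs₀ : s₀ ∈ states θ)
    {g : ℝ} (hg : 0 ≤ g) {h : State → ℝ} (h0 : ∀ s ∈ states θ, 0 ≤ h s)
    (hsub : ∀ s ∈ states θ, ∀ u, h s + g ≤ s.age + nextMean θ h s u) (T : ℕ) :
    (T : ℝ≥0∞) * ENNReal.ofReal g ≤ (∑ t ∈ Finset.range T, expectedAge θ π s₀ t) +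
      stateMean θ π s₀ T fun s => ENNReal.ofReal (h s) := by
  have step : ∀ t, (stateMean θ π s₀ t fun s => ENNReal.ofReal (h s)) + ENNReal.ofReal g ≤
      expectedAge θ π s₀ t + stateMean θ π s₀ (t + 1) fun s => ENNReal.ofReal (h s) := by
    intro t
    rw [expectedAge_eq_stateMean, stateMean_succ]
    unfold stateMean
    rw [← pmfMean_add, ← pmfMean_const (historyLaw θ π s₀ t) (ENNReal.ofReal g), ← pmfMean_add]
    refine pmfMean_mono fun x hx => ?_
    have hx' := mem_states_of_mem_support_historyLaw θ π hs₀ t x hx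
    beta_reduce
    rw [← pmfMean_const (π x) (ENNReal.ofReal (h x.2) + ENNReal.ofReal g),
      ← pmfMean_const (π x) (x.2.age : ℝ≥0∞), ← pmfMean_add]
    refine pmfMean_mono fun u _ => ?_
    rw [pmfMean_transition θ fun b => h0 _ (nextState_mem_states θ hx' u b),
      ← ENNReal.ofReal_add (h0 _ hx') hg, ← ENNReal.ofReal_natCast]
    exact (ENNReal.ofReal_le_ofReal (hsub _ hx' u)).trans ENNReal.ofReal_add_le
  have key : ∀ T : ℕ, (stateMean θ π s₀ 0 fun s => ENNReal.ofReal (h s)) +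
      (T : ℝ≥0∞) * ENNReal.ofReal g ≤ (∑ t ∈ Finset.range T, expectedAge θ π s₀ t) +
      stateMean θ π s₀ T fun s => ENNReal.ofReal (h s) := by
    intro T
    induction T with
    | zero => simp
    | succ T ih =>
      rw [Finset.sum_range_succ, Nat.cast_succ, add_mul, one_mul, ← add_assoc]
      refine (add_le_add_left ih _).trans ?_
      rw [add_assoc, add_assoc]
      exact add_le_add_right (step T) _
  exact le_add_self.trans (key T)

/-- A nonnegative supersolution of the average-cost equation bounds the accumulated age from
above. -/
theorem supersolution_bound (θ : Params) {μ : State → Action} {s₀ : State}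
    (hs₀ : s₀ ∈ states θ) {g : ℝ} (hg : 0 ≤ g) {h : State → ℝ} (h0 : ∀ s ∈ states θ, 0 ≤ h s)
    (hsup : ∀ s ∈ states θ, s.age + nextMean θ h s (μ s) ≤ h s + g) (T : ℕ) :
    ∑ t ∈ Finset.range T, expectedAge θ (stationary μ) s₀ t ≤
      ENNReal.ofReal (h s₀) + (T : ℝ≥0∞) * ENNReal.ofReal g := by
  set π := stationary μ with hπ
  have step : ∀ t, (expectedAge θ π s₀ t +
      stateMean θ π s₀ (t + 1) fun s => ENNReal.ofReal (h s)) ≤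
      (stateMean θ π s₀ t fun s => ENNReal.ofReal (h s)) + ENNReal.ofReal g := by
    intro t
    rw [expectedAge_eq_stateMean, stateMean_succ]
    unfold stateMean
    rw [← pmfMean_add, ← pmfMean_const (historyLaw θ π s₀ t) (ENNReal.ofReal g), ← pmfMean_add]
    refine pmfMean_mono fun x hx => ?_
    have hx' := mem_states_of_mem_support_historyLaw θ π hs₀ t x hx
    have hn := fun b => h0 _ (nextState_mem_states θ hx' (μ x.2) b)
    beta_reduce
    rw [hπ, stationary, pmfMean_pure, pmfMean_transition θ hn,
      ← ENNReal.ofReal_add (h0 _ hx') hg, ← ENNReal.ofReal_natCast,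
      ← ENNReal.ofReal_add (Nat.cast_nonneg _)]
    · exact ENNReal.ofReal_le_ofReal (hsup _ hx')
    · exact add_nonneg (mul_nonneg (onProb_nonneg _ _) (hn _))
        (mul_nonneg (sub_nonneg.2 (onProb_le_one _ _)) (hn _))
  have key : ∀ T : ℕ, ((∑ t ∈ Finset.range T, expectedAge θ π s₀ t) +
      stateMean θ π s₀ T fun s => ENNReal.ofReal (h s)) ≤
      (stateMean θ π s₀ 0 fun s => ENNReal.ofReal (h s)) + (T : ℝ≥0∞) * ENNReal.ofReal g := by
    intro T
    induction T with
    | zero => simp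
    | succ T ih =>
      rw [Finset.sum_range_succ, Nat.cast_succ, add_mul, one_mul, ← add_assoc, add_assoc]
      refine (add_le_add_right (step T) _).trans ?_
      rw [← add_assoc]
      exact add_le_add_left ih _
  rw [← stateMean_zero θ π s₀ fun s => ENNReal.ofReal (h s)]
  exact le_self_add.trans (key T)

theorem sum_Icc_one_le_sum_range (e : ℕ → ℝ≥0∞) (T : ℕ) :
    ∑ t ∈ Finset.Icc 1 T, e t ≤ ∑ t ∈ Finset.range (T + 1), e t :=
  Finset.sum_le_sum_of_subset fun t ht => by
    simp only [Finset.mem_Icc, Finset.mem_range] at ht ⊢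
    omega

theorem sum_range_eq_add_sum_Icc_one (e : ℕ → ℝ≥0∞) (T : ℕ) :
    ∑ t ∈ Finset.range (T + 1), e t = e 0 + ∑ t ∈ Finset.Icc 1 T, e t := by
  rw [Finset.range_eq_Ico, Finset.sum_eq_sum_Ico_succ_bot (by omega)]
  congr 1

theorem limsup_average_le {e : ℕ → ℝ≥0∞} {c g : ℝ} (hc : 0 ≤ c) (hg : 0 ≤ g)
    (h : ∀ T : ℕ, ∑ t ∈ Finset.range T, e t ≤
      ENNReal.ofReal c + (T : ℝ≥0∞) * ENNReal.ofReal g) :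
    Filter.limsup (fun T : ℕ => (∑ t ∈ Finset.Icc 1 T, e t) / (T : ℝ≥0∞)) Filter.atTop ≤
      ENNReal.ofReal g := by
  have hlim : Filter.Tendsto (fun T : ℕ => ENNReal.ofReal ((c + g) / (T : ℝ) + g))
      Filter.atTop (nhds (ENNReal.ofReal g)) := by
    refine ENNReal.tendsto_ofReal ?_
    simpa using (tendsto_const_div_atTop_nhds_zero_nat (c + g)).add_const g
  rw [← hlim.limsup_eq]
  refine Filter.limsup_le_limsup ?_
  filter_upwards [Filter.eventually_ge_atTop 1] with T hT
  have hT' : (0 : ℝ) < T := by exact_mod_cast hT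
  refine ENNReal.div_le_of_le_mul ?_
  refine (sum_Icc_one_le_sum_range e T).trans ((h (T + 1)).trans (le_of_eq ?_))
  rw [← ENNReal.ofReal_natCast, ← ENNReal.ofReal_natCast, ← ENNReal.ofReal_mul (by positivity),
    ← ENNReal.ofReal_mul (by positivity), ← ENNReal.ofReal_add hc (by positivity)]
  congr 1
  push_cast
  field_simp
  ring

/-- The terminal term `B * e T` cannot be dropped, since ages may be unbounded. If `c < g`, the gap
must be filled by `e T`, so `e T` eventually exceeds `|c| + 1`; then the sums outgrow `c' + c * T`.
-/
theorem le_of_average_bound {e : ℕ → ℝ} (he : ∀ t, 0 ≤ e t) {A B c c' g : ℝ} (hB : 0 < B)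
    (hlow : ∀ T : ℕ, T * g ≤ (∑ t ∈ Finset.range T, e t) + (A + B * e T))
    (hup : ∀ᶠ T : ℕ in Filter.atTop, ∑ t ∈ Finset.range T, e t ≤ c' + c * T) : g ≤ c := by
  by_contra! hcg
  obtain ⟨N, hN⟩ := Filter.eventually_atTop.1 hup
  -- From this time on, `T * (g - c)` covers `c' + A` and still leaves `B * (|c| + 1)` for the
  -- terminal term.
  obtain ⟨N', hN'⟩ := exists_nat_ge ((c' + A + B * (|c| + 1)) / (g - c))
  rw [div_le_iff₀ (by linarith)] at hN'
  have hbig : ∀ T : ℕ, max N N' ≤ T → |c| + 1 ≤ e T := by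
    intro T hT
    have h1 := hN T (le_trans (le_max_left _ _) hT)
    have h2 := hlow T
    have h3 : (N' : ℝ) ≤ T := by exact_mod_cast (le_max_right N N').trans hT
    have h4 : (N' : ℝ) * (g - c) ≤ T * (g - c) :=
      mul_le_mul_of_nonneg_right h3 (by linarith)
    have h5 : B * (|c| + 1) ≤ B * e T := by nlinarith
    exact le_of_mul_le_mul_left h5 hB
  have hsum : ∀ n : ℕ, (n : ℝ) * (|c| + 1) ≤
      ∑ t ∈ Finset.range (max N N' + n), e t := by
    intro n
    induction n with
    | zero => simpa using Finset.sum_nonneg fun t _ => he t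
    | succ n ih =>
      rw [← add_assoc, Finset.sum_range_succ]
      have := hbig (max N N' + n) (by omega)
      push_cast
      linarith
  set m := max N N' with hm
  obtain ⟨n, hn⟩ := exists_nat_gt (c' + c * m)
  have h1 := hN (m + n) (by rw [hm]; exact (le_max_left _ _).trans (Nat.le_add_right _ _))
  have h2 := hsum n
  push_cast at h1
  have h3 := le_abs_self c
  have h4 : (0 : ℝ) ≤ n := Nat.cast_nonneg n
  nlinarith

theorem le_limsup_average {e : ℕ → ℝ≥0∞} (he0 : e 0 ≠ ∞) {A B g : ℝ} (hA : 0 ≤ A) (hB : 0 < B)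
    (h : ∀ T : ℕ, (T : ℝ≥0∞) * ENNReal.ofReal g ≤ (∑ t ∈ Finset.range T, e t) +
      (ENNReal.ofReal A + ENNReal.ofReal B * e T)) :
    ENNReal.ofReal g ≤
      Filter.limsup (fun T : ℕ => (∑ t ∈ Finset.Icc 1 T, e t) / (T : ℝ≥0∞)) Filter.atTop := by
  by_contra! hlt
  obtain ⟨c, hc1, hc2⟩ := exists_between hlt
  have hctop : c ≠ ∞ := (hc2.trans_le le_top).ne
  have hg : 0 ≤ g := by
    by_contra! hg
    simp [ENNReal.ofReal_of_nonpos hg.le] at hc2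
  have hev := Filter.eventually_lt_of_limsup_lt hc1
  have hev' : ∀ᶠ T : ℕ in Filter.atTop,
      ∑ t ∈ Finset.range (T + 1), e t ≤ e 0 + c * (T : ℝ≥0∞) := by
    filter_upwards [hev, Filter.eventually_ge_atTop 1] with T hT hT1
    rw [sum_range_eq_add_sum_Icc_one]
    refine add_le_add_right ?_ _
    exact (ENNReal.div_le_iff (by simp; omega) (by simp)).1 hT.le
  -- An average eventually below the finite `c` forces all terms to be finite, so the real version
  -- applies.
  have hfin : ∀ t, e t ≠ ∞ := by
    intro t
    obtain ⟨N, hN⟩ := Filter.eventually_atTop.1 hev'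
    have h1 := hN (max N t) (le_max_left _ _)
    have h2 : e t ≤ ∑ t ∈ Finset.range (max N t + 1), e t :=
      Finset.single_le_sum (fun _ _ => zero_le) (by simp)
    refine ((h2.trans h1).trans_lt ?_).ne
    exact ENNReal.add_lt_top.2 ⟨he0.lt_top, ENNReal.mul_lt_top hctop.lt_top (by simp)⟩
  have hsumfin : ∀ T, ∑ t ∈ Finset.range T, e t ≠ ∞ := fun T =>
    (ENNReal.sum_lt_top.2 fun t _ => (hfin t).lt_top).ne
  have hle : g ≤ c.toReal := by
    refine le_of_average_bound (e := fun t => (e t).toReal) (fun t => ENNReal.toReal_nonneg)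
      (A := A) (B := B) (c' := (e 0).toReal) hB ?_ ?_
    · intro T
      have h1 := ENNReal.toReal_mono (by
        refine ENNReal.add_ne_top.2 ⟨hsumfin T, ENNReal.add_ne_top.2 ⟨by simp, ?_⟩⟩
        exact ENNReal.mul_ne_top (by simp) (hfin T)) (h T)
      rw [ENNReal.toReal_add (hsumfin T) (ENNReal.add_ne_top.2 ⟨by simp,
        ENNReal.mul_ne_top (by simp) (hfin T)⟩), ENNReal.toReal_add (by simp)
        (ENNReal.mul_ne_top (by simp) (hfin T)), ENNReal.toReal_mul, ENNReal.toReal_mul,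
        ENNReal.toReal_ofReal hg, ENNReal.toReal_ofReal hA, ENNReal.toReal_ofReal hB.le,
        ENNReal.toReal_sum fun t _ => hfin t] at h1
      simpa using h1
    · filter_upwards [hev'] with T hT
      have h0 : ∑ t ∈ Finset.range T, e t ≤ ∑ t ∈ Finset.range (T + 1), e t :=
        Finset.sum_le_sum_of_subset (Finset.range_mono (Nat.le_succ T))
      have h1 := ENNReal.toReal_mono (ENNReal.add_ne_top.2 ⟨he0,
        ENNReal.mul_ne_top hctop (by simp)⟩) (h0.trans hT)
      rw [ENNReal.toReal_add he0 (ENNReal.mul_ne_top hctop (by simp)), ENNReal.toReal_mul,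
        ENNReal.toReal_sum fun t _ => hfin t] at h1
      simpa using h1
  exact absurd hc2 (not_lt.2 (ENNReal.ofReal_le_of_le_toReal hle))

/-- Verification: if `h`, dominated by an affine function of the age, is a subsolution of the
average-cost equation for all actions, and `k` is a supersolution under `μ`, with the same gain,
then `μ` is optimal. -/
theorem isOptimal_of_verification (θ : Params) {μ : State → Action}
    (hμ : ∀ s : State, 1 ≤ s.l2 → μ s = Action.none) {g A B : ℝ} (hg : 0 ≤ g) (hA : 0 ≤ A)
    (hB : 0 < B) {h k : State → ℝ} (h0 : ∀ s ∈ states θ, 0 ≤ h s)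
    (hAB : ∀ s ∈ states θ, h s ≤ A + B * s.age)
    (hsub : ∀ s ∈ states θ, ∀ u, h s + g ≤ s.age + nextMean θ h s u)
    (k0 : ∀ s ∈ states θ, 0 ≤ k s)
    (hsup : ∀ s ∈ states θ, s.age + nextMean θ k s (μ s) ≤ k s + g) : IsOptimal θ μ := by
  have hadm : Admissible (stationary μ) := fun h hh => by rw [stationary, hμ _ hh]
  refine ⟨hadm, fun s₀ hs₀ => le_antisymm ?_ (iInf₂_le (stationary μ) hadm)⟩
  refine le_trans (limsup_average_le (k0 s₀ hs₀) hg (supersolution_bound θ hs₀ hg k0 hsup)) ?_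
  refine le_iInf₂ fun π _ => le_limsup_average ?_ hA hB fun T => ?_
  · rw [expectedAge_eq_stateMean, stateMean_zero]
    simp
  · refine (subsolution_bound θ π hs₀ hg h0 hsub T).trans (add_le_add_right ?_ _)
    rw [expectedAge_eq_stateMean, stateMean, stateMean, ← pmfMean_const_mul,
      ← pmfMean_const (historyLaw θ π s₀ T) (ENNReal.ofReal A), ← pmfMean_add]
    refine pmfMean_mono fun x hx => ?_
    have hx' := mem_states_of_mem_support_historyLaw θ π hs₀ T x hx
    rw [← ENNReal.ofReal_natCast, ← ENNReal.ofReal_mul hB.le,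
      ← ENNReal.ofReal_add hA (by positivity)]
    exact ENNReal.ofReal_le_ofReal (hAB _ hx')

/-! ### The relative value function of the discounted problem -/

/-- An upper bound for the growth rate in the age of the value of an OFF state. -/
def growth (θ : Params) : ℝ := max θ.d (1 / (1 - θ.p))

theorem d_le_growth (θ : Params) : (θ.d : ℝ) ≤ growth θ := le_max_left _ _

theorem one_le_growth (θ : Params) : 1 ≤ growth θ := by
  have h : (2 : ℝ) ≤ θ.d := by exact_mod_cast θ.two_le_d
  linarith [d_le_growth θ]

theorem one_add_mul_growth_le (θ : Params) : 1 + θ.p * growth θ ≤ growth θ := by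
  have h1 : 0 < 1 - θ.p := sub_pos.2 θ.p_lt_one
  have h2 : 1 / (1 - θ.p) ≤ growth θ := le_max_right _ _
  rw [div_le_iff₀ h1] at h2
  linarith

theorem nextMean_mono (θ : Params) {v w : State → ℝ} (h : ∀ s, v s ≤ w s) (s : State)
    (u : Action) : nextMean θ v s u ≤ nextMean θ w s u :=
  add_le_add (mul_le_mul_of_nonneg_left (h _) (onProb_nonneg _ _))
    (mul_le_mul_of_nonneg_left (h _) (sub_nonneg.2 (onProb_le_one _ _)))

theorem nextMean_idle_ch1 (θ : Params) (v : State → ℝ) (δ : ℕ) (l : Bool) :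
    nextMean θ v ⟨δ, l, 0⟩ Action.ch1 =
      onProb θ l * v ⟨1, true, 0⟩ + (1 - onProb θ l) * v ⟨δ + 1, false, 0⟩ := rfl

theorem nextMean_idle_none (θ : Params) (v : State → ℝ) (δ : ℕ) (l : Bool) :
    nextMean θ v ⟨δ, l, 0⟩ Action.none =
      onProb θ l * v ⟨δ + 1, true, 0⟩ + (1 - onProb θ l) * v ⟨δ + 1, false, 0⟩ := rfl

theorem nextMean_idle_ch2 (θ : Params) (v : State → ℝ) (δ : ℕ) (l : Bool) :
    nextMean θ v ⟨δ, l, 0⟩ Action.ch2 = onProb θ l * v ⟨δ + 1, true, θ.d - 1⟩ +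
      (1 - onProb θ l) * v ⟨δ + 1, false, θ.d - 1⟩ := rfl

theorem nextMean_busy_one (θ : Params) (v : State → ℝ) (δ : ℕ) (l : Bool) (u : Action) :
    nextMean θ v ⟨δ, l, 1⟩ u = onProb θ l * v ⟨θ.d, true, 0⟩ +
      (1 - onProb θ l) * v ⟨θ.d, false, 0⟩ := by
  cases u <;> rfl

theorem nextMean_busy_add_two (θ : Params) (v : State → ℝ) (δ : ℕ) (l : Bool) (k : ℕ)
    (u : Action) : nextMean θ v ⟨δ, l, k + 2⟩ u = onProb θ l * v ⟨δ + 1, true, k + 1⟩ +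
      (1 - onProb θ l) * v ⟨δ + 1, false, k + 1⟩ := by
  cases u <;> rfl

/-- The smaller expectation at the next state of the two transmission decisions. -/
def minMean (θ : Params) (v : State → ℝ) (s : State) : ℝ :=
  min (nextMean θ v s Action.ch1) (nextMean θ v s Action.ch2)

theorem minMean_mono (θ : Params) {v w : State → ℝ} (h : ∀ s, v s ≤ w s) (s : State) :
    minMean θ v s ≤ minMean θ w s :=
  min_le_min (nextMean_mono θ h _ _) (nextMean_mono θ h _ _)

theorem minMean_le_of_le (θ : Params) {v : State → ℝ} {s s' : State} {c : ℝ}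
    (h : ∀ u, nextMean θ v s u ≤ nextMean θ v s' u + c) :
    minMean θ v s ≤ minMean θ v s' + c := by
  unfold minMean
  rw [← min_add_add_right]
  exact min_le_min (h _) (h _)

/-- Convex combinations preserve an additive comparison. -/
theorem onProb_comb_le (θ : Params) (l : Bool) {a a' b b' c : ℝ} (ha : a ≤ a' + c)
    (hb : b ≤ b' + c) : onProb θ l * a + (1 - onProb θ l) * b ≤
      onProb θ l * a' + (1 - onProb θ l) * b' + c := by
  have h1 := mul_le_mul_of_nonneg_left ha (onProb_nonneg θ l)
  have h2 := mul_le_mul_of_nonneg_left hb (sub_nonneg.2 (onProb_le_one θ l))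
  linarith

/-- Value iteration for the discounted problem. -/
def valueIter (θ : Params) (α : ℝ) : ℕ → State → ℝ
  | 0 => fun _ => 0
  | n + 1 => fun s => s.age + α * minMean θ (valueIter θ α n) s

theorem valueIter_succ (θ : Params) (α : ℝ) (n : ℕ) (s : State) :
    valueIter θ α (n + 1) s = s.age + α * minMean θ (valueIter θ α n) s := rfl

/-! ### Bounds for discounted value iteration -/

section discounted

variable (θ : Params) {α : ℝ}

theorem valueIter_nonneg (h0 : 0 ≤ α) (n : ℕ) (s : State) : 0 ≤ valueIter θ α n s := by
  induction n generalizing s with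
  | zero => exact le_rfl
  | succ n ih =>
    rw [valueIter_succ]
    have h : 0 ≤ minMean θ (valueIter θ α n) s := by
      refine le_trans (le_of_eq ?_) (minMean_mono θ (v := fun _ => 0) ih s)
      simp [minMean, nextMean]
    positivity

theorem valueIter_le_succ (h0 : 0 ≤ α) (n : ℕ) (s : State) :
    valueIter θ α n s ≤ valueIter θ α (n + 1) s := by
  induction n generalizing s with
  | zero => exact valueIter_nonneg θ h0 1 s
  | succ n ih =>
    rw [valueIter_succ, valueIter_succ]
    have := mul_le_mul_of_nonneg_left (minMean_mono θ ih s) h0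
    linarith

theorem nextState_age_le (s : State) (u : Action) (b : Bool) :
    (nextState θ s u b).age ≤ s.age + θ.d := by
  obtain ⟨δ, l, k⟩ := s
  have hd := θ.two_le_d
  rcases k with _ | _ | k
  · cases u <;> cases b <;> simp [nextState] <;> omega
  · cases u <;> simp [nextState]
  · cases u <;> simp [nextState] <;> omega

/-- The age grows by at most d per slot, and the right side is a supersolution for that growth. It
makes the monotone iteration converge. -/
theorem valueIter_le (h0 : 0 ≤ α) (h1 : α < 1) (n : ℕ) (s : State) :
    valueIter θ α n s ≤ s.age * (1 / (1 - α)) + θ.d * (1 / (1 - α)) ^ 2 := by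
  have hx : 0 < 1 / (1 - α) := one_div_pos.2 (sub_pos.2 h1)
  have hx1 : 1 + α * (1 / (1 - α)) = 1 / (1 - α) := by
    have : 1 - α ≠ 0 := (sub_pos.2 h1).ne'
    field_simp
    ring
  set x := 1 / (1 - α)
  induction n generalizing s with
  | zero =>
    change (0 : ℝ) ≤ _
    positivity
  | succ n ih =>
    have hb : ∀ u b, valueIter θ α n (nextState θ s u b) ≤
        (s.age + θ.d) * x + θ.d * x ^ 2 := by
      intro u b
      refine (ih _).trans ?_
      have : ((nextState θ s u b).age : ℝ) ≤ s.age + θ.d := by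
        exact_mod_cast nextState_age_le θ s u b
      gcongr
    have hm : minMean θ (valueIter θ α n) s ≤ (s.age + θ.d) * x + θ.d * x ^ 2 := by
      refine (min_le_left _ _).trans ?_
      have := onProb_comb_le θ s.l1 (a' := 0) (b' := 0) (c := (s.age + θ.d) * x + θ.d * x ^ 2)
        (by simpa using hb Action.ch1 true) (by simpa using hb Action.ch1 false)
      simpa [nextMean] using this
    rw [valueIter_succ]
    have := mul_le_mul_of_nonneg_left hm h0
    have e1 : (s.age : ℝ) + α * ((s.age + θ.d) * x + θ.d * x ^ 2) =
        s.age * (1 + α * x) + θ.d * x * α * (1 + x) := by ring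
    have e2 : α * (1 + x) ≤ x := by nlinarith
    have e3 : θ.d * x * (α * (1 + x)) ≤ θ.d * x * x :=
      mul_le_mul_of_nonneg_left e2 (by positivity)
    rw [hx1] at e1
    nlinarith

/-- Each slot costs at least 1. In the limit this is the bound `1 ≤ g`. -/
theorem geom_le_valueIter (h0 : 0 ≤ α) (h1 : α < 1) (n : ℕ) {s : State} (hs : 1 ≤ s.age) :
    1 - α ^ n ≤ (1 - α) * valueIter θ α n s := by
  induction n generalizing s with
  | zero => simp [valueIter]
  | succ n ih =>
    have hage : ∀ u b, 1 ≤ (nextState θ s u b).age := by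
      intro u b
      obtain ⟨δ, l, k⟩ := s
      have hd := θ.two_le_d
      rcases k with _ | _ | k
      · cases u <;> cases b <;> simp [nextState]
      · cases u <;> simp [nextState] <;> omega
      · cases u <;> simp [nextState]
    have hu : ∀ u, 1 - α ^ n ≤ (1 - α) * nextMean θ (valueIter θ α n) s u := by
      intro u
      have := onProb_comb_le θ s.l1 (c := 0) (by simpa using ih (hage u true))
        (by simpa using ih (hage u false))
      unfold nextMean
      linarith
    have hm : 1 - α ^ n ≤ (1 - α) * minMean θ (valueIter θ α n) s := by
      unfold minMean
      rcases min_choice (nextMean θ (valueIter θ α n) s Action.ch1)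
        (nextMean θ (valueIter θ α n) s Action.ch2) with h | h <;> rw [h] <;> exact hu _
    rw [valueIter_succ]
    have hs' : (1 : ℝ) ≤ s.age := by exact_mod_cast hs
    have := mul_le_mul_of_nonneg_left hm h0
    rw [pow_succ]
    nlinarith

theorem valueIter_mono_age (h0 : 0 ≤ α) (n δ : ℕ) (l : Bool) (k : ℕ) :
    valueIter θ α n ⟨δ, l, k⟩ ≤ valueIter θ α n ⟨δ + 1, l, k⟩ := by
  induction n generalizing δ l k with
  | zero => exact le_rfl
  | succ n ih =>
    rw [valueIter_succ, valueIter_succ]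
    have hm : minMean θ (valueIter θ α n) ⟨δ, l, k⟩ ≤
        minMean θ (valueIter θ α n) ⟨δ + 1, l, k⟩ := by
      rw [← add_zero (minMean _ _ ⟨δ + 1, l, k⟩)]
      refine minMean_le_of_le θ fun u => ?_
      rcases k with _ | _ | k
      · cases u <;> simp only [nextMean_idle_ch1, nextMean_idle_ch2, nextMean_idle_none]
        · exact onProb_comb_le θ l (by simp) (by simpa using ih _ _ _)
        · exact onProb_comb_le θ l (by simpa using ih _ _ _) (by simpa using ih _ _ _)
        · exact onProb_comb_le θ l (by simpa using ih _ _ _) (by simpa using ih _ _ _)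
      · simp [nextMean_busy_one]
      · rw [nextMean_busy_add_two, nextMean_busy_add_two]
        exact onProb_comb_le θ l (by simpa using ih _ _ _) (by simpa using ih _ _ _)
    have := mul_le_mul_of_nonneg_left hm h0
    push_cast
    linarith

/-- On a busy channel an extra unit of age is paid only until delivery resets the age to d. In an
idle OFF state it costs at most d via Channel 2, and via Channel 1 it costs 1 now plus, with
probability p, the same increment again; `growth` is stable under both. -/
theorem valueIter_growth (h0 : 0 ≤ α) (h1 : α < 1) (n : ℕ) :
    (∀ δ l k, valueIter θ α n ⟨δ + 1, l, k + 1⟩ ≤ valueIter θ α n ⟨δ, l, k + 1⟩ + (k + 1)) ∧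
    ∀ δ, valueIter θ α n ⟨δ + 1, false, 0⟩ ≤ valueIter θ α n ⟨δ, false, 0⟩ + growth θ := by
  have hM := one_le_growth θ
  induction n with
  | zero =>
    refine ⟨fun δ l k => ?_, fun δ => ?_⟩ <;> change (0 : ℝ) ≤ 0 + _ <;> positivity
  | succ n ih =>
    obtain ⟨ih1, ih2⟩ := ih
    refine ⟨fun δ l k => ?_, fun δ => ?_⟩
    · rw [valueIter_succ, valueIter_succ]
      have hm : minMean θ (valueIter θ α n) ⟨δ + 1, l, k + 1⟩ ≤
          minMean θ (valueIter θ α n) ⟨δ, l, k + 1⟩ + k := by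
        refine minMean_le_of_le θ fun u => ?_
        rcases k with _ | k
        · simp [nextMean_busy_one]
        · rw [nextMean_busy_add_two, nextMean_busy_add_two]
          push_cast
          exact onProb_comb_le θ l (ih1 _ _ _) (ih1 _ _ _)
      have h2 := mul_le_mul_of_nonneg_left hm h0
      have h3 : α * (k : ℝ) ≤ k := mul_le_of_le_one_left (Nat.cast_nonneg k) h1.le
      push_cast
      linarith
    · rw [valueIter_succ, valueIter_succ]
      have hm : minMean θ (valueIter θ α n) ⟨δ + 1, false, 0⟩ ≤
          minMean θ (valueIter θ α n) ⟨δ, false, 0⟩ + (growth θ - 1) := by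
        unfold minMean
        rw [← min_add_add_right]
        refine min_le_min ?_ ?_
        · rw [nextMean_idle_ch1, nextMean_idle_ch1]
          have h2 := mul_le_mul_of_nonneg_left (ih2 (δ + 1)) θ.p_pos.le
          have h3 := one_add_mul_growth_le θ
          simp only [onProb, Bool.false_eq_true, if_false]
          linarith
        · rw [nextMean_idle_ch2, nextMean_idle_ch2]
          obtain ⟨e, he⟩ : ∃ e, θ.d = e + 2 := ⟨θ.d - 2, by have := θ.two_le_d; omega⟩
          have hg := d_le_growth θ
          rw [he] at hg ⊢
          push_cast at hg
          have h4 := fun l => (ih1 (δ + 1) l e).trans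
            (add_le_add_right (show ((e : ℝ) + 1) ≤ growth θ - 1 by linarith) _)
          exact onProb_comb_le θ false (h4 _) (h4 _)
      have h2 := mul_le_mul_of_nonneg_left hm h0
      have h3 : α * (growth θ - 1) ≤ growth θ - 1 :=
        mul_le_of_le_one_left (by linarith) h1.le
      push_cast
      linarith

end discounted

/-- `(g, h)` solves the optimality equation with discount factor `α`, relative to the state
`(1, ON, idle)`; `h` is monotone in the age and grows at most linearly on the OFF states. -/
structure RelativeValue (θ : Params) (α g : ℝ) (h : State → ℝ) : Prop where
  eqn : ∀ s, h s = s.age - g + α * minMean θ h s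
  base : h ⟨1, true, 0⟩ = 0
  mono : ∀ δ l k, h ⟨δ, l, k⟩ ≤ h ⟨δ + 1, l, k⟩
  growth_le : ∀ δ, h ⟨δ + 1, false, 0⟩ ≤ h ⟨δ, false, 0⟩ + growth θ
  one_le : 1 ≤ g

theorem tendsto_minMean (θ : Params) {ι : Type*} {F : Filter ι} {v : ι → State → ℝ}
    {w : State → ℝ} (h : ∀ s, Filter.Tendsto (fun i => v i s) F (nhds (w s))) (s : State) :
    Filter.Tendsto (fun i => minMean θ (v i) s) F (nhds (minMean θ w s)) :=
  (((h _).const_mul _).add ((h _).const_mul _)).min (((h _).const_mul _).add ((h _).const_mul _))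

theorem minMean_sub_const (θ : Params) (v : State → ℝ) (c : ℝ) (s : State) :
    minMean θ (fun s => v s - c) s = minMean θ v s - c := by
  have h : ∀ u, nextMean θ (fun s => v s - c) s u = nextMean θ v s u - c := fun u => by
    unfold nextMean
    ring
  rw [minMean, h, h, min_sub_sub_right, minMean]

/-- Value iteration increases to a fixed point V. Subtracting c = V(1, ON, idle) leaves the constant
(1 - α) c, which is the gain. -/
theorem exists_relativeValue_of_discount (θ : Params) {α : ℝ} (h0 : 0 ≤ α) (h1 : α < 1) :
    ∃ g h, RelativeValue θ α g h := by
  have hmono : ∀ s, Monotone fun n => valueIter θ α n s := fun s =>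
    monotone_nat_of_le_succ fun n => valueIter_le_succ θ h0 n s
  have hlim : ∀ s, ∃ x, Filter.Tendsto (fun n => valueIter θ α n s) Filter.atTop (nhds x) :=
    fun s => ⟨_, tendsto_atTop_ciSup (hmono s)
      ⟨_, Set.forall_mem_range.2 fun n => valueIter_le θ h0 h1 n s⟩⟩
  choose V hV using hlim
  have hV_eq : ∀ s, V s = s.age + α * minMean θ V s := fun s =>
    tendsto_nhds_unique ((hV s).comp (Filter.tendsto_add_atTop_nat 1))
      (((tendsto_minMean θ hV s).const_mul α).const_add _)
  set c := V ⟨1, true, 0⟩ with hc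
  refine ⟨(1 - α) * c, fun s => V s - c, ?_, by simp [hc], ?_, ?_, ?_⟩
  · intro s
    rw [minMean_sub_const, hV_eq s]
    ring
  · intro δ l k
    exact sub_le_sub_right (le_of_tendsto_of_tendsto' (hV _) (hV _) fun n =>
      valueIter_mono_age θ h0 n δ l k) _
  · intro δ
    have := le_of_tendsto_of_tendsto' (hV _) ((hV _).add_const _) fun n =>
      (valueIter_growth θ h0 h1 n).2 δ
    linarith
  · have h2 : Filter.Tendsto (fun n : ℕ => 1 - α ^ n) Filter.atTop (nhds (1 - 0)) :=
      (tendsto_pow_atTop_nhds_zero_of_lt_one h0 h1).const_sub 1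
    rw [sub_zero] at h2
    exact le_of_tendsto_of_tendsto' h2 ((hV _).const_mul _) fun n =>
      geom_le_valueIter θ h0 h1 n le_rfl

/-! ### The relative value function of the average-cost problem -/

namespace RelativeValue

variable {θ : Params} {α g : ℝ} {h : State → ℝ}

theorem mono_age (H : RelativeValue θ α g h) (l : Bool) (k : ℕ) :
    Monotone fun δ => h ⟨δ, l, k⟩ :=
  monotone_nat_of_le_succ fun δ => H.mono δ l k

theorem le_ch1 (H : RelativeValue θ α g h) (h0 : 0 ≤ α) (δ : ℕ) (l : Bool) :
    h ⟨δ, l, 0⟩ ≤ δ - g + α * ((1 - onProb θ l) * h ⟨δ + 1, false, 0⟩) := by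
  rw [H.eqn]
  have h1 : minMean θ h ⟨δ, l, 0⟩ ≤ (1 - onProb θ l) * h ⟨δ + 1, false, 0⟩ := by
    refine (min_le_left _ _).trans ?_
    rw [nextMean_idle_ch1, H.base, mul_zero, zero_add]
  have := mul_le_mul_of_nonneg_left h1 h0
  linarith

/-- Channel 1 at (1, ON) gives 0 ≤ 1 - g + α (1 - q) h(2, OFF), and g ≥ 1. This anchors the OFF
values from below. -/
theorem two_off_nonneg (H : RelativeValue θ α g h) (h0 : 0 < α) : 0 ≤ h ⟨2, false, 0⟩ := by
  have h1 := H.le_ch1 h0.le 1 true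
  have h2 := H.one_le
  have h3 : 0 < α * (1 - θ.q) := mul_pos h0 (sub_pos.2 θ.q_lt_one)
  rw [H.base] at h1
  simp only [onProb, if_true, Nat.cast_one] at h1
  by_contra! hneg
  have : α * ((1 - θ.q) * h ⟨1 + 1, false, 0⟩) < 0 := by
    rw [← mul_assoc]
    exact mul_neg_of_pos_of_neg h3 hneg
  linarith

/-- Channel 1 bounds h(δ) through p h(δ+1), and `growth_le` brings h(δ+1) back to h(δ); since p < 1,
the inequality can be solved for h(δ). -/
theorem off_le (H : RelativeValue θ α g h) (h0 : 0 < α) (h1 : α ≤ 1) (δ : ℕ) :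
    h ⟨δ, false, 0⟩ ≤ (δ + growth θ) / (1 - θ.p) := by
  have hp : 0 < 1 - θ.p := sub_pos.2 θ.p_lt_one
  have hM := one_le_growth θ
  rw [le_div_iff₀ hp]
  rcases le_total (h ⟨δ, false, 0⟩) 0 with hneg | hpos
  · have : h ⟨δ, false, 0⟩ * (1 - θ.p) ≤ 0 := mul_nonpos_of_nonpos_of_nonneg hneg hp.le
    have : (0 : ℝ) ≤ δ := Nat.cast_nonneg δ
    linarith
  · have h2 := H.le_ch1 h0.le δ false
    have h3 := H.growth_le δ
    have h4 := H.one_le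
    have h5 : 0 ≤ h ⟨δ + 1, false, 0⟩ := hpos.trans (H.mono _ _ _)
    simp only [onProb, Bool.false_eq_true, if_false, sub_sub_cancel] at h2
    have h6 : α * (θ.p * h ⟨δ + 1, false, 0⟩) ≤ θ.p * h ⟨δ + 1, false, 0⟩ :=
      mul_le_of_le_one_left (mul_nonneg θ.p_pos.le h5) h1
    have h7 := mul_le_mul_of_nonneg_left h3 θ.p_pos.le
    have h8 := θ.p_lt_one
    nlinarith

theorem le_gain_bound (H : RelativeValue θ α g h) (h0 : 0 < α) (h1 : α ≤ 1) :
    g ≤ 1 + (2 + growth θ) / (1 - θ.p) := by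
  have h2 := H.le_ch1 h0.le 1 true
  have h3 := H.off_le h0 h1 2
  have h4 := H.two_off_nonneg h0
  have h5 : α * ((1 - θ.q) * h ⟨2, false, 0⟩) ≤ h ⟨2, false, 0⟩ := by
    rw [← mul_assoc]
    refine mul_le_of_le_one_left h4 ?_
    have := θ.q_pos
    have := θ.q_lt_one
    nlinarith
  rw [H.base] at h2
  simp only [onProb, if_true] at h2
  push_cast at h2 h3
  linarith

end RelativeValue

/-! ### Bounds uniform in the discount factor -/

/-- The relative values at `s` are bounded uniformly in the discount factor. -/
def UniformlyBoundedAt (θ : Params) (s : State) : Prop :=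
  ∃ B : ℝ, ∀ α g h, 0 < α → α ≤ 1 → RelativeValue θ α g h → |h s| ≤ B

theorem abs_nextMean_le (θ : Params) (h : State → ℝ) (s : State) (u : Action) :
    |nextMean θ h s u| ≤ |h (nextState θ s u true)| + |h (nextState θ s u false)| := by
  have h1 := onProb_nonneg θ s.l1
  have h2 := onProb_le_one θ s.l1
  refine (abs_add_le _ _).trans ?_
  rw [abs_mul, abs_mul, abs_of_nonneg h1, abs_of_nonneg (sub_nonneg.2 h2)]
  exact add_le_add (mul_le_of_le_one_left (abs_nonneg _) h2)
    (mul_le_of_le_one_left (abs_nonneg _) (by linarith))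

theorem UniformlyBoundedAt.of_next {θ : Params} {s : State}
    (h1 : ∀ b, UniformlyBoundedAt θ (nextState θ s Action.ch1 b))
    (h2 : ∀ b, UniformlyBoundedAt θ (nextState θ s Action.ch2 b)) :
    UniformlyBoundedAt θ s := by
  choose B₁ hB₁ using h1
  choose B₂ hB₂ using h2
  refine ⟨s.age + (1 + (2 + growth θ) / (1 - θ.p)) +
    ((B₁ true + B₁ false) + (B₂ true + B₂ false)), fun α g h h0 h1 H => ?_⟩
  have e1 := (abs_nextMean_le θ h s Action.ch1).trans
    (add_le_add (hB₁ true α g h h0 h1 H) (hB₁ false α g h h0 h1 H))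
  have e2 := (abs_nextMean_le θ h s Action.ch2).trans
    (add_le_add (hB₂ true α g h h0 h1 H) (hB₂ false α g h h0 h1 H))
  have e3 : |minMean θ h s| ≤ (B₁ true + B₁ false) + (B₂ true + B₂ false) := by
    unfold minMean
    have p1 := (abs_nonneg _).trans e1
    have p2 := (abs_nonneg _).trans e2
    rcases min_choice (nextMean θ h s Action.ch1) (nextMean θ h s Action.ch2) with e | e <;>
      rw [e] <;> linarith
  have e4 : |α * minMean θ h s| ≤ |minMean θ h s| := by
    rw [abs_mul, abs_of_pos h0]
    exact mul_le_of_le_one_left (abs_nonneg _) h1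
  have e5 := H.one_le
  have e6 := H.le_gain_bound h0 h1
  have e7 : (0 : ℝ) ≤ s.age := Nat.cast_nonneg _
  have e8 := abs_le.1 (e4.trans e3)
  rw [H.eqn, abs_le]
  constructor <;> linarith [e8.1, e8.2]

/-- The lower bound descends from h(2, OFF) ≥ 0 to age 0 in two steps of size at most `growth`. -/
theorem uniformlyBoundedAt_off (θ : Params) (δ : ℕ) : UniformlyBoundedAt θ ⟨δ, false, 0⟩ := by
  refine ⟨(δ + growth θ) / (1 - θ.p) + 2 * growth θ, fun α g h h0 h1 H => ?_⟩
  have hM := one_le_growth θ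
  have hp : 0 < 1 - θ.p := sub_pos.2 θ.p_lt_one
  have hpos : 0 ≤ (δ + growth θ) / (1 - θ.p) := by positivity
  have e1 := H.off_le h0 h1 δ
  have e2 : h ⟨0, false, 0⟩ ≤ h ⟨δ, false, 0⟩ := H.mono_age false 0 (Nat.zero_le δ)
  have e3 := H.growth_le 0
  have e4 := H.growth_le 1
  have e5 := H.two_off_nonneg h0
  rw [abs_le]
  constructor <;> linarith

theorem uniformlyBoundedAt_on (θ : Params) {δ : ℕ} (hδ : 1 ≤ δ) :
    UniformlyBoundedAt θ ⟨δ, true, 0⟩ := by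
  obtain ⟨B, hB⟩ := uniformlyBoundedAt_off θ (δ + 1)
  refine ⟨δ + B, fun α g h h0 h1 H => ?_⟩
  have e1 : h ⟨1, true, 0⟩ ≤ h ⟨δ, true, 0⟩ := H.mono_age true 0 hδ
  rw [H.base] at e1
  rw [abs_of_nonneg e1]
  have e2 := H.le_ch1 h0.le δ true
  have e3 := H.one_le
  simp only [onProb, if_true] at e2
  have e4 : α * ((1 - θ.q) * h ⟨δ + 1, false, 0⟩) ≤ |h ⟨δ + 1, false, 0⟩| := by
    refine (le_abs_self _).trans ?_
    have hq : 0 ≤ 1 - θ.q := (sub_pos.2 θ.q_lt_one).le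
    rw [← mul_assoc, abs_mul, abs_of_nonneg (mul_nonneg h0.le hq)]
    refine mul_le_of_le_one_left (abs_nonneg _) ?_
    have := θ.q_pos
    nlinarith
  have e5 := hB α g h h0 h1 H
  linarith

/-- Bounds pass backwards along transitions: from idle states of age d to busy states, by induction
on the remaining time, and then to idle ON states of any age, including the spurious age 0. -/
theorem uniformlyBoundedAt (θ : Params) (s : State) : UniformlyBoundedAt θ s := by
  have hd : 1 ≤ θ.d := by have := θ.two_le_d; omega
  have hbusy : ∀ k δ l, UniformlyBoundedAt θ ⟨δ, l, k + 1⟩ := by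
    intro k
    induction k with
    | zero =>
      intro δ l
      refine .of_next (fun b => ?_) fun b => ?_ <;>
      · cases b
        · exact uniformlyBoundedAt_off θ _
        · exact uniformlyBoundedAt_on θ hd
    | succ k ih =>
      intro δ l
      exact .of_next (fun b => ih _ _) fun b => ih _ _
  obtain ⟨δ, l, k⟩ := s
  rcases k with _ | k
  · cases l
    · exact uniformlyBoundedAt_off θ δ
    · refine .of_next (fun b => ?_) fun b => ?_
      · cases b
        · exact uniformlyBoundedAt_off θ _
        · exact uniformlyBoundedAt_on θ le_rfl
      · obtain ⟨e, he⟩ : ∃ e, θ.d - 1 = e + 1 := ⟨θ.d - 2, by have := θ.two_le_d; omega⟩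
        change UniformlyBoundedAt θ ⟨δ + 1, b, θ.d - 1⟩
        rw [he]
        exact hbusy _ _ _
  · exact hbusy _ _ _

/-- Countability makes the product of intervals below first countable, so that compactness provides
convergent subsequences. -/
instance : Countable State :=
  Function.Injective.countable (f := fun s : State => (s.age, s.l1, s.l2)) fun s t h => by
    cases s
    cases t
    simpa using h

/-- The average-cost optimality equation has a solution. -/
theorem exists_relativeValue (θ : Params) : ∃ g h, RelativeValue θ 1 g h := by
  -- The shift by 2 keeps every discount factor strictly positive.
  set α : ℕ → ℝ := fun n => 1 - 1 / ((n : ℝ) + 2) with hα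
  have hα0 : ∀ n, 0 < α n := fun n => by
    rw [hα]
    refine sub_pos.2 ((div_lt_one (by positivity)).2 ?_)
    have : (0 : ℝ) ≤ n := Nat.cast_nonneg n
    linarith
  have hα1 : ∀ n, α n < 1 := fun n => by
    rw [hα]
    exact sub_lt_self _ (by positivity)
  have hαlim : Filter.Tendsto α Filter.atTop (nhds 1) := by
    have h1 := (tendsto_one_div_add_atTop_nhds_zero_nat (𝕜 := ℝ)).comp
      (Filter.tendsto_add_atTop_nat 1)
    have h2 := h1.const_sub 1
    rw [sub_zero] at h2
    refine h2.congr fun n => ?_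
    simp only [Function.comp_apply, hα]
    push_cast
    ring
  choose g h H using fun n => exists_relativeValue_of_discount θ (hα0 n).le (hα1 n)
  choose B hB using uniformlyBoundedAt θ
  have hcomp : IsCompact (Set.univ.pi fun s => Set.Icc (-B s) (B s)) :=
    isCompact_univ_pi fun s => isCompact_Icc
  have hmem : ∀ n, (g n, h n) ∈ Set.Icc (1 : ℝ) (1 + (2 + growth θ) / (1 - θ.p)) ×ˢ
      Set.univ.pi fun s => Set.Icc (-B s) (B s) := fun n =>
    ⟨⟨(H n).one_le, (H n).le_gain_bound (hα0 n) (hα1 n).le⟩, fun s _ =>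
      abs_le.1 (hB s _ _ _ (hα0 n) (hα1 n).le (H n))⟩
  obtain ⟨⟨g', h'⟩, -, φ, hφ, hlim⟩ := (isCompact_Icc.prod hcomp).tendsto_subseq hmem
  rw [nhds_prod_eq] at hlim
  have hg : Filter.Tendsto (fun n => g (φ n)) Filter.atTop (nhds g') :=
    Filter.tendsto_fst.comp hlim
  have hh' : Filter.Tendsto (fun n => h (φ n)) Filter.atTop (nhds h') :=
    Filter.tendsto_snd.comp hlim
  have hh := tendsto_pi_nhds.1 hh'
  refine ⟨g', h', ?_, ?_, ?_, ?_, ?_⟩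
  · intro s
    refine tendsto_nhds_unique (hh s) ?_
    have := (hg.const_sub (s.age : ℝ)).add
      ((hαlim.comp hφ.tendsto_atTop).mul (tendsto_minMean θ hh s))
    exact this.congr fun n => ((H (φ n)).eqn s).symm
  · refine tendsto_nhds_unique (hh _) ?_
    exact tendsto_const_nhds.congr fun n => (H (φ n)).base.symm
  · exact fun δ l k => le_of_tendsto_of_tendsto' (hh _) (hh _) fun n => (H (φ n)).mono δ l k
  · exact fun δ => le_of_tendsto_of_tendsto' (hh _) ((hh _).add_const _) fun n =>
      (H (φ n)).growth_le δ
  · exact ge_of_tendsto' hg fun n => (H (φ n)).one_le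

/-! ### Channel 1 over several slots -/

/-- The transition operator of Channel 1. -/
def channelStep (θ : Params) (φ : Bool → ℝ) (l : Bool) : ℝ :=
  onProb θ l * φ true + (1 - onProb θ l) * φ false

theorem channelStep_iterate_succ (θ : Params) (φ : Bool → ℝ) (k : ℕ) (l : Bool) :
    (channelStep θ)^[k + 1] φ l = onProb θ l * (channelStep θ)^[k] φ true +
      (1 - onProb θ l) * (channelStep θ)^[k] φ false := by
  rw [Function.iterate_succ_apply', channelStep]

/-- The chain fixes constants, and p + q - 1 is its other eigenvalue. -/
theorem channelStep_iterate_sub (θ : Params) (φ : Bool → ℝ) (k : ℕ) :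
    (channelStep θ)^[k] φ false - (channelStep θ)^[k] φ true =
      (θ.p + θ.q - 1) ^ k * (φ false - φ true) := by
  induction k with
  | zero => simp
  | succ k ih =>
    rw [Function.iterate_succ_apply', pow_succ, mul_right_comm, ← ih]
    simp only [channelStep, onProb, Bool.false_eq_true, if_false, if_true]
    ring

theorem channelStep_iterate_mem (θ : Params) (φ : Bool → ℝ) (k : ℕ) (l : Bool) :
    ∃ η : ℝ, 0 ≤ η ∧ η ≤ 1 ∧
      (channelStep θ)^[k] φ l = φ true + η * (φ false - φ true) := by
  induction k generalizing l with
  | zero =>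
    cases l
    · exact ⟨1, by norm_num, by norm_num, by simp⟩
    · exact ⟨0, by norm_num, by norm_num, by simp⟩
  | succ k ih =>
    obtain ⟨a, ha0, ha1, ha⟩ := ih true
    obtain ⟨b, hb0, hb1, hb⟩ := ih false
    have h1 := onProb_nonneg θ l
    have h2 := sub_nonneg.2 (onProb_le_one θ l)
    refine ⟨onProb θ l * a + (1 - onProb θ l) * b, by positivity, by nlinarith, ?_⟩
    rw [Function.iterate_succ_apply', channelStep, ha, hb]
    ring

/-! ### Action values -/

/-- The constant term of the value of starting a transmission on Channel 2. -/
def ch2Const (θ : Params) (g : ℝ) (h : State → ℝ) (l : Bool) : ℝ :=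
  θ.d * (θ.d - 1) / 2 - θ.d * g + (channelStep θ)^[θ.d] (fun b => h ⟨θ.d, b, 0⟩) l

/-- How much worse Channel 1 is than Channel 2 in an idle state. -/
def ch1Excess (θ : Params) (g : ℝ) (h : State → ℝ) (δ : ℕ) (l : Bool) : ℝ :=
  (δ - g + (1 - onProb θ l) * h ⟨δ + 1, false, 0⟩) - (θ.d * δ + ch2Const θ g h l)

namespace RelativeValue

variable {θ : Params} {g : ℝ} {h : State → ℝ}

/-- No decision matters while Channel 2 is busy: the ages δ, …, δ + k are paid, and then the age is
d and Channel 1 has moved k + 1 steps. -/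
theorem busy_eq (H : RelativeValue θ 1 g h) (k δ : ℕ) (l : Bool) :
    h ⟨δ, l, k + 1⟩ = (k + 1) * δ + (k + 1) * k / 2 - (k + 1) * g +
      (channelStep θ)^[k + 1] (fun b => h ⟨θ.d, b, 0⟩) l := by
  induction k generalizing δ l with
  | zero =>
    rw [H.eqn, minMean, nextMean_busy_one, nextMean_busy_one, min_self]
    simp [channelStep]
  | succ k ih =>
    rw [H.eqn, minMean, nextMean_busy_add_two, nextMean_busy_add_two, min_self, ih, ih,
      channelStep_iterate_succ θ _ (k + 1)]
    push_cast
    ring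

theorem nextMean_ch1 (H : RelativeValue θ 1 g h) (δ : ℕ) (l : Bool) :
    nextMean θ h ⟨δ, l, 0⟩ Action.ch1 = (1 - onProb θ l) * h ⟨δ + 1, false, 0⟩ := by
  rw [nextMean_idle_ch1, H.base, mul_zero, zero_add]

theorem nextMean_ch2 (H : RelativeValue θ 1 g h) (δ : ℕ) (l : Bool) :
    δ - g + nextMean θ h ⟨δ, l, 0⟩ Action.ch2 = θ.d * δ + ch2Const θ g h l := by
  obtain ⟨e, he⟩ : ∃ e, θ.d = e + 2 := ⟨θ.d - 2, by have := θ.two_le_d; omega⟩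
  have he' : θ.d - 1 = e + 1 := by omega
  rw [nextMean_idle_ch2, he', H.busy_eq, H.busy_eq, ch2Const]
  have hit : (channelStep θ)^[θ.d] = (channelStep θ)^[(e + 1) + 1] := by rw [he]
  rw [hit, channelStep_iterate_succ θ _ (e + 1)]
  have hd : (θ.d : ℝ) = e + 2 := by exact_mod_cast he
  rw [hd]
  push_cast
  ring

theorem idle_eq (H : RelativeValue θ 1 g h) (δ : ℕ) (l : Bool) :
    h ⟨δ, l, 0⟩ = min (δ - g + (1 - onProb θ l) * h ⟨δ + 1, false, 0⟩)
      (θ.d * δ + ch2Const θ g h l) := by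
  rw [H.eqn, minMean, one_mul, ← min_add_add_left, H.nextMean_ch2, H.nextMean_ch1]

theorem idle_le_ch2 (H : RelativeValue θ 1 g h) (δ : ℕ) (l : Bool) :
    h ⟨δ, l, 0⟩ ≤ θ.d * δ + ch2Const θ g h l := by
  rw [H.idle_eq]
  exact min_le_right _ _

theorem off_le_ch1 (H : RelativeValue θ 1 g h) (δ : ℕ) :
    h ⟨δ, false, 0⟩ ≤ δ - g + θ.p * h ⟨δ + 1, false, 0⟩ := by
  simpa [onProb] using H.le_ch1 zero_le_one δ false

theorem on_le_ch1 (H : RelativeValue θ 1 g h) (δ : ℕ) :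
    h ⟨δ, true, 0⟩ ≤ δ - g + (1 - θ.q) * h ⟨δ + 1, false, 0⟩ := by
  simpa [onProb] using H.le_ch1 zero_le_one δ true

theorem off_eq_or (H : RelativeValue θ 1 g h) (δ : ℕ) :
    h ⟨δ, false, 0⟩ = δ - g + θ.p * h ⟨δ + 1, false, 0⟩ ∨
      h ⟨δ, false, 0⟩ = θ.d * δ + ch2Const θ g h false := by
  have := H.idle_eq δ false
  simp only [onProb, Bool.false_eq_true, if_false, sub_sub_cancel] at this
  rcases min_choice (δ - g + θ.p * h ⟨δ + 1, false, 0⟩)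
    (θ.d * δ + ch2Const θ g h false) with e | e
  · exact Or.inl (this.trans e)
  · exact Or.inr (this.trans e)

/-- The values of the OFF states grow at least at the smaller of the rates of the two channels. -/
theorem min_le_growth (H : RelativeValue θ 1 g h) (δ : ℕ) :
    min (θ.d : ℝ) (1 / (1 - θ.p)) ≤ h ⟨δ + 1, false, 0⟩ - h ⟨δ, false, 0⟩ := by
  have hp0 := θ.p_pos
  have hp : 0 < 1 - θ.p := sub_pos.2 θ.p_lt_one
  set t := min (θ.d : ℝ) (1 / (1 - θ.p)) with ht
  have ht1 : t ≤ θ.d := min_le_left _ _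
  have ht2 : t * (1 - θ.p) ≤ 1 := (le_div_iff₀ hp).1 (min_le_right _ _)
  have ht0 : 0 ≤ t := le_min (Nat.cast_nonneg _) (one_div_pos.2 hp).le
  -- Bootstrap from monotonicity: if Channel 2 is optimal at δ + 1 the increment is at least d; if
  -- Channel 1 is, it is at least 1 plus p times the next increment, so the deficit shrinks by a
  -- factor p.
  have key : ∀ n δ, t * (1 - θ.p ^ n) ≤ h ⟨δ + 1, false, 0⟩ - h ⟨δ, false, 0⟩ := by
    intro n
    induction n with
    | zero => exact fun δ => by simpa using H.mono δ false 0
    | succ n ih =>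
      intro δ
      rcases H.off_eq_or (δ + 1) with e | e
      · have e1 := H.off_le_ch1 δ
        have e2 := mul_le_mul_of_nonneg_left (ih (δ + 1)) hp0.le
        rw [pow_succ]
        push_cast at e
        nlinarith
      · have e1 := H.idle_le_ch2 δ false
        push_cast at e
        have e2 : 0 ≤ t * θ.p ^ (n + 1) := by positivity
        linarith
  have hlim : Filter.Tendsto (fun n : ℕ => t * (1 - θ.p ^ n)) Filter.atTop
      (nhds (t * (1 - 0))) :=
    ((tendsto_pow_atTop_nhds_zero_of_lt_one hp0.le θ.p_lt_one).const_sub 1).const_mul t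
  rw [sub_zero, mul_one] at hlim
  exact le_of_tendsto' hlim fun n => key n δ

/-- The value of an OFF state is at most the cost of using Channel 1 until it succeeds. -/
theorem off_le_always_ch1 (H : RelativeValue θ 1 g h) (δ : ℕ) :
    h ⟨δ, false, 0⟩ ≤ 1 / (1 - θ.p) * (δ + 1 / (1 - θ.p) - 1 - g) := by
  have hp0 := θ.p_pos
  have hp : 0 < 1 - θ.p := sub_pos.2 θ.p_lt_one
  have hm : θ.p * (1 / (1 - θ.p)) = 1 / (1 - θ.p) - 1 := by
    field_simp
    ring
  have hoff : ∀ δ : ℕ, h ⟨δ, false, 0⟩ ≤ (δ + growth θ) * (1 / (1 - θ.p)) := fun δ => by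
    rw [mul_one_div]
    exact H.off_le zero_lt_one le_rfl δ
  set m := 1 / (1 - θ.p)
  -- The subtracted function solves w(δ) = δ - g + p w(δ+1). The a priori bound has the same slope
  -- m, so the difference is at most a constant, which each step multiplies by p.
  have key : ∀ (n δ : ℕ), h ⟨δ, false, 0⟩ - m * (δ + m - 1 - g) ≤
      θ.p ^ n * ((growth θ - (m - 1 - g)) * m) := by
    intro n
    induction n with
    | zero =>
      intro δ
      have := hoff δ
      rw [pow_zero, one_mul]
      linarith
    | succ n ih =>
      intro δ
      have e1 := H.off_le_ch1 δ
      have e2 := mul_le_mul_of_nonneg_left (ih (δ + 1)) hp0.le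
      have e3 : θ.p * (m * ((δ + 1 : ℕ) + m - 1 - g)) = (m - 1) * (δ + m - g) := by
        rw [← mul_assoc, hm]
        push_cast
        ring
      rw [pow_succ]
      linarith
  have hlim := (tendsto_pow_atTop_nhds_zero_of_lt_one hp0.le θ.p_lt_one).mul_const
    ((growth θ - (m - 1 - g)) * m)
  rw [zero_mul] at hlim
  exact sub_nonpos.1 (ge_of_tendsto' hlim fun n => key n δ)

/-! ### Monotonicity of the excess in the age -/

theorem excess_off_succ_sub (θ : Params) (g : ℝ) (h : State → ℝ) (δ : ℕ) :
    ch1Excess θ g h (δ + 1) false - ch1Excess θ g h δ false =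
      1 + θ.p * (h ⟨δ + 2, false, 0⟩ - h ⟨δ + 1, false, 0⟩) - θ.d := by
  simp only [ch1Excess, onProb, Bool.false_eq_true, if_false]
  push_cast
  ring

theorem excess_on_succ_sub (θ : Params) (g : ℝ) (h : State → ℝ) (δ : ℕ) :
    ch1Excess θ g h (δ + 1) true - ch1Excess θ g h δ true =
      1 + (1 - θ.q) * (h ⟨δ + 2, false, 0⟩ - h ⟨δ + 1, false, 0⟩) - θ.d := by
  simp only [ch1Excess, onProb, if_true]
  push_cast
  ring

/-- Here m ≤ d, so increments are at most d, and 1 + p d ≤ d. -/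
theorem excess_off_antitone (H : RelativeValue θ 1 g h) (hF : F θ ≤ 0) (δ : ℕ) :
    ch1Excess θ g h (δ + 1) false ≤ ch1Excess θ g h δ false := by
  have hM : growth θ = θ.d := max_eq_left (by unfold F at hF; linarith)
  have e1 := excess_off_succ_sub θ g h δ
  have e2 := H.growth_le (δ + 1)
  have e3 := one_add_mul_growth_le θ
  rw [hM] at e2 e3
  have e4 := mul_le_mul_of_nonneg_left (sub_le_iff_le_add'.2 e2) θ.p_pos.le
  linarith

/-- Here d < m, so increments are at least d, and 1 + p d > d. -/
theorem excess_off_monotone (H : RelativeValue θ 1 g h) (hF : 0 < F θ) (δ : ℕ) :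
    ch1Excess θ g h δ false ≤ ch1Excess θ g h (δ + 1) false := by
  have hp : 0 < 1 - θ.p := sub_pos.2 θ.p_lt_one
  have hd : (θ.d : ℝ) < 1 / (1 - θ.p) := by unfold F at hF; linarith
  have e1 := excess_off_succ_sub θ g h δ
  have e2 := H.min_le_growth (δ + 1)
  rw [min_eq_left hd.le] at e2
  rw [lt_div_iff₀ hp] at hd
  have e4 := mul_le_mul_of_nonneg_left e2 θ.p_pos.le
  linarith

theorem excess_on_monotone (H : RelativeValue θ 1 g h)
    (hc : 0 ≤ 1 + (1 - θ.q) * min (θ.d : ℝ) (1 / (1 - θ.p)) - θ.d) :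
    Monotone fun δ => ch1Excess θ g h δ true := by
  refine monotone_nat_of_le_succ fun δ => ?_
  have e1 := excess_on_succ_sub θ g h δ
  have e4 := mul_le_mul_of_nonneg_left (H.min_le_growth (δ + 1)) (sub_pos.2 θ.q_lt_one).le
  linarith

/-- The minimum is d, and the lower bound for the increments of the excess is exactly G. -/
theorem excess_on_monotone_of_mem_B₃ (H : RelativeValue θ 1 g h) (hB : θ ∈ B₃) :
    Monotone fun δ => ch1Excess θ g h δ true := by
  obtain ⟨hF, hG⟩ := hB
  unfold F at hF
  unfold G at hG
  refine H.excess_on_monotone ?_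
  rw [min_eq_left (by linarith)]
  linarith

/-- The minimum is m, and the lower bound for the increments of the excess is exactly H. -/
theorem excess_on_monotone_of_mem_B₄ (H : RelativeValue θ 1 g h) (hB : θ ∈ B₄) :
    Monotone fun δ => ch1Excess θ g h δ true := by
  obtain ⟨hF, hH⟩ := hB
  unfold F at hF
  unfold HeteroAoI.H at hH
  refine H.excess_on_monotone ?_
  rw [min_eq_right (by linarith), mul_one_div]
  linarith

/-! ### Channel 1 in the state `(d, ON)` -/

/-- If Channel 2 is better in the state `(d, ON)`, then `(d, OFF)` is no worse than `(d, ON)`, the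
gain is at least that of always using Channel 2 up to this difference, and the difference vanishes
unless Channel 1 is optimal in `(d, OFF)`. -/
theorem of_excess_on_pos (H : RelativeValue θ 1 g h) (hpos : 0 < ch1Excess θ g h θ.d true) :
    ∃ x : ℝ, x ≤ 0 ∧ (x = 0 ∨ (θ.p + θ.q - 1) * h ⟨θ.d + 1, false, 0⟩ ≤ x) ∧
      (θ.d * (3 * θ.d - 1) / 2 + x ≤ θ.d * g) ∧
      ch2Const θ g h false - ch2Const θ g h true = (θ.p + θ.q - 1) ^ θ.d * x := by
  have hp0 := θ.p_pos
  have hp1 := θ.p_lt_one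
  have hq0 := θ.q_pos
  have hq1 := θ.q_lt_one
  have hd2 := θ.two_le_d
  have hz : (θ.p + θ.q - 1) ^ θ.d < 1 := by
    refine (le_abs_self _).trans_lt ?_
    rw [abs_pow]
    exact pow_lt_one₀ (abs_nonneg _) (abs_lt.2 ⟨by linarith, by linarith⟩) (by omega)
  have hdiff : ch2Const θ g h false - ch2Const θ g h true =
      (θ.p + θ.q - 1) ^ θ.d * (h ⟨θ.d, false, 0⟩ - h ⟨θ.d, true, 0⟩) := by
    rw [← channelStep_iterate_sub θ (fun b => h ⟨θ.d, b, 0⟩) θ.d, ch2Const, ch2Const]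
    ring
  have hon : h ⟨θ.d, true, 0⟩ = θ.d * θ.d + ch2Const θ g h true := by
    rw [H.idle_eq]
    exact min_eq_right (sub_pos.1 hpos).le
  have hoff := H.idle_le_ch2 θ.d false
  -- The difference x satisfies x ≤ (p + q - 1)^d x with a factor below 1.
  have hx : h ⟨θ.d, false, 0⟩ - h ⟨θ.d, true, 0⟩ ≤ 0 := by
    by_contra! hcon
    nlinarith
  refine ⟨_, hx, ?_, ?_, hdiff⟩
  · rcases H.off_eq_or θ.d with e | e
    · right
      have := H.on_le_ch1 θ.d
      linarith
    · left
      have e1 : (1 - (θ.p + θ.q - 1) ^ θ.d) * (h ⟨θ.d, false, 0⟩ - h ⟨θ.d, true, 0⟩) = 0 := by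
        linarith
      exact (mul_eq_zero.1 e1).resolve_left (sub_pos.2 hz).ne'
  -- Channel 2 returns to age d, so h(d, ON) cancels from its own equation; what is left is d g =
  -- d(3d-1)/2 + η x with 0 ≤ η ≤ 1.
  · obtain ⟨η, hη0, hη1, hη⟩ := channelStep_iterate_mem θ (fun b => h ⟨θ.d, b, 0⟩) θ.d true
    rw [ch2Const, hη] at hon
    nlinarith

theorem off_succ_d_nonneg (H : RelativeValue θ 1 g h) : 0 ≤ h ⟨θ.d + 1, false, 0⟩ :=
  (H.two_off_nonneg zero_lt_one).trans
    (H.mono_age false 0 (by have := θ.two_le_d; omega : 2 ≤ θ.d + 1))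

/-- Here q ≥ 1/d > 1 - p, so the channel has nonnegative memory p + q - 1. This forces x = 0, hence
equal Channel 2 constants and g ≥ d. Bounding h(d+1, OFF) by Channel 2 then makes the excess at most
(d - g) + d G - q (d + C) ≤ 0, where C is the common constant and d + C ≥ h(1, ON) = 0. -/
theorem excess_on_nonpos_of_mem_B₂ (H : RelativeValue θ 1 g h) (hB : θ ∈ B₂) :
    ch1Excess θ g h θ.d true ≤ 0 := by
  by_contra! hpos
  obtain ⟨hF, hG⟩ := hB
  have hp : 0 < 1 - θ.p := sub_pos.2 θ.p_lt_one
  have hd : (2 : ℝ) ≤ θ.d := by exact_mod_cast θ.two_le_d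
  have hd1 : (θ.d : ℝ) * (1 - θ.p) < 1 := (lt_div_iff₀ hp).1 (by unfold F at hF; linarith)
  unfold G at hG
  have hκ : 0 ≤ θ.p + θ.q - 1 := by
    by_contra! hneg
    nlinarith
  obtain ⟨x, hx0, hx, hgain, hC⟩ := H.of_excess_on_pos hpos
  have hf := H.off_succ_d_nonneg
  have hx' : x = 0 := hx.elim id fun e => le_antisymm hx0 ((mul_nonneg hκ hf).trans e)
  subst hx'
  have hC1 := H.idle_le_ch2 1 true
  rw [H.base] at hC1
  have hf2 := H.idle_le_ch2 (θ.d + 1) false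
  have hq0 := θ.q_pos
  have e1 := mul_le_mul_of_nonneg_left hf2 (sub_pos.2 θ.q_lt_one).le
  have e2 : (θ.d : ℝ) ≤ g := by nlinarith
  simp only [ch1Excess, onProb, if_true] at hpos
  push_cast at hC1 e1
  rw [show ch2Const θ g h false = ch2Const θ g h true by linarith] at e1
  nlinarith [mul_nonneg hq0.le (show 0 ≤ θ.d + ch2Const θ g h true by linarith)]

/-- Using Channel 1 forever gives g ≤ d, below (3d-1)/2. So x < 0, which requires p + q < 1; even
then x is not negative enough to reconcile the two bounds on g. -/
theorem excess_on_nonpos_of_mem_B₁ (H : RelativeValue θ 1 g h) (hB : θ ∈ B₁) :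
    ch1Excess θ g h θ.d true ≤ 0 := by
  by_contra! hpos
  obtain ⟨hF, hH⟩ := hB
  unfold F at hF
  unfold HeteroAoI.H at hH
  have hp : 0 < 1 - θ.p := sub_pos.2 θ.p_lt_one
  have hq0 := θ.q_pos
  have hq1 := sub_pos.2 θ.q_lt_one
  have hd : (2 : ℝ) ≤ θ.d := by exact_mod_cast θ.two_le_d
  obtain ⟨x, hx0, hx, hgain, -⟩ := H.of_excess_on_pos hpos
  have hf := H.off_succ_d_nonneg
  have hfle := H.off_le_always_ch1 (θ.d + 1)
  have hf2 := H.off_le_always_ch1 2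
  have hon := H.on_le_ch1 1
  rw [H.base] at hon
  have hpm : (1 - θ.p) * (1 / (1 - θ.p)) = 1 := mul_one_div_cancel hp.ne'
  rw [← mul_one_div] at hH
  have hg1 := H.one_le
  set m := 1 / (1 - θ.p) with hm
  have hm1 : 1 ≤ m := by
    rw [hm, le_div_iff₀ hp]
    linarith [θ.p_pos]
  have hmd : m ≤ θ.d := by linarith
  push_cast at hfle hf2 hon
  have hon2 := mul_le_mul_of_nonneg_left hf2 hq1.le
  -- The mean time between deliveries when only Channel 1 is used; H ≤ 0 says that it is at most d.
  set m₁ := 1 + (1 - θ.q) * m with hm₁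
  have hm₁d : m₁ ≤ θ.d := by linarith
  have hm₁1 : 1 < m₁ := by nlinarith
  have hgm : g * m₁ ≤ m₁ + (m₁ - 1) * m := by nlinarith
  have hgd : g ≤ θ.d := by
    have : (m₁ - 1) * m ≤ m₁ * (θ.d - 1) := by nlinarith
    by_contra! hcon
    nlinarith
  have hxlt : x ≠ 0 := by
    rintro rfl
    nlinarith
  have hxf := hx.resolve_left hxlt
  have hκ : θ.p + θ.q - 1 < 0 := by
    by_contra! hκ
    exact hxlt (le_antisymm hx0 ((mul_nonneg hκ hf).trans hxf))
  have hxy : -((1 - θ.q * m) * (θ.d + m - g)) ≤ x := by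
    have e1 := mul_le_mul_of_nonneg_left hfle (neg_pos.2 hκ).le
    have e2 : -(θ.p + θ.q - 1) * m = 1 - θ.q * m := by linarith
    have e3 : -(θ.p + θ.q - 1) * (m * (θ.d + 1 + m - 1 - g)) =
        (1 - θ.q * m) * (θ.d + m - g) := by
      rw [← mul_assoc, e2]
      ring
    linarith
  have hs : 0 < θ.d + m - g := by linarith
  -- For d ≥ 3 the crude bound 1 - q m < 1 suffices. For d = 2 it does not: there H ≤ 0 gives 1 - q
  -- m ≤ 2 - m, hence 1 + m² ≤ m g, against g ≤ 1 + m/2.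
  rcases Nat.lt_or_ge θ.d 3 with h3 | h3
  · have hd2 : (θ.d : ℝ) = 2 := by
      have : θ.d = 2 := by have := θ.two_le_d; omega
      exact_mod_cast this
    rw [hd2] at hgain hxy hs hm₁d hmd
    have e1 : (1 - θ.q * m) * (2 + m - g) ≤ (2 - m) * (2 + m - g) :=
      mul_le_mul_of_nonneg_right (by linarith) hs.le
    have e2 : 1 + m ^ 2 ≤ m * g := by nlinarith
    have e3 : g ≤ 1 + m / 2 := by
      by_contra! hcon
      nlinarith
    nlinarith [sq_nonneg (m - 1)]
  · have hd3 : (3 : ℝ) ≤ θ.d := by exact_mod_cast h3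
    have e1 : (1 - θ.q * m) * (θ.d + m - g) < 1 * (θ.d + m - g) :=
      mul_lt_mul_of_pos_right (by nlinarith) hs
    nlinarith

end RelativeValue

/-! ### The optimal policy -/

open Classical in
/-- The better channel in an idle state, Channel 1 in case of a tie. -/
def greedy (θ : Params) (g : ℝ) (h : State → ℝ) (δ : ℕ) (l : Bool) : Action :=
  if ch1Excess θ g h δ l ≤ 0 then Action.ch1 else Action.ch2

/-- The policy that is greedy in the idle OFF states and in the idle ON states of age `1` and `d`,
and is constant in the age on the ON states of age below `d`, and of age at least `d`. -/
def thresholdPolicy (θ : Params) (g : ℝ) (h : State → ℝ) (s : State) : Action :=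
  if s.l2 = 0 then
    if s.l1 then
      if s.age < θ.d then greedy θ g h 1 true else greedy θ g h θ.d true
    else greedy θ g h s.age false
  else Action.none

theorem greedy_of_nonpos {θ : Params} {g : ℝ} {h : State → ℝ} {δ : ℕ} {l : Bool}
    (hle : ch1Excess θ g h δ l ≤ 0) : greedy θ g h δ l = Action.ch1 := if_pos hle

theorem greedy_of_pos {θ : Params} {g : ℝ} {h : State → ℝ} {δ : ℕ} {l : Bool}
    (hlt : 0 < ch1Excess θ g h δ l) : greedy θ g h δ l = Action.ch2 := if_neg (not_le.2 hlt)

theorem thresholdPolicy_off (θ : Params) (g : ℝ) (h : State → ℝ) (δ : ℕ) :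
    thresholdPolicy θ g h ⟨δ, false, 0⟩ = greedy θ g h δ false := by
  simp [thresholdPolicy]

theorem thresholdPolicy_on (θ : Params) (g : ℝ) (h : State → ℝ) (δ : ℕ) :
    thresholdPolicy θ g h ⟨δ, true, 0⟩ =
      if δ < θ.d then greedy θ g h 1 true else greedy θ g h θ.d true := by
  simp [thresholdPolicy]

theorem thresholdPolicy_busy (θ : Params) (g : ℝ) (h : State → ℝ) {s : State}
    (hs : 1 ≤ s.l2) : thresholdPolicy θ g h s = Action.none :=
  if_neg (by omega)

/-- An upward closed property of natural numbers holds exactly from some threshold on. -/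
theorem exists_threshold {P : ℕ → Prop} (hP : ∀ n, P n → P (n + 1)) :
    ∃ lam : ℕ∞, ∀ n : ℕ, ((n : ℕ∞) < lam → ¬ P n) ∧ (lam ≤ (n : ℕ∞) → P n) := by
  classical
  by_cases hex : ∃ n, P n
  · refine ⟨(Nat.find hex : ℕ), fun n => ⟨fun hn => ?_, fun hn => ?_⟩⟩
    · exact Nat.find_min hex (by exact_mod_cast hn)
    · have hn' : Nat.find hex ≤ n := by exact_mod_cast hn
      exact Nat.le_induction (Nat.find_spec hex) (fun m _ hm => hP m hm) n hn'
  · exact ⟨⊤, fun n => ⟨fun _ hn => hex ⟨n, hn⟩, fun hn => absurd hn (by simp)⟩⟩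

namespace RelativeValue

variable {θ : Params} {g : ℝ} {h : State → ℝ}

/-! ### Threshold structure of the policy -/

theorem off_nonIncreasing (H : RelativeValue θ 1 g h) (hF : F θ ≤ 0) :
    NonIncreasingInAge (thresholdPolicy θ g h) false := by
  obtain ⟨lam, hlam⟩ := exists_threshold (P := fun δ => ch1Excess θ g h δ false ≤ 0)
    fun δ hδ => (H.excess_off_antitone hF δ).trans hδ
  refine ⟨lam, fun δ _ => ⟨fun hδ => ?_, fun hδ => ?_⟩⟩ <;> rw [thresholdPolicy_off]
  · exact greedy_of_pos (not_le.1 ((hlam δ).1 hδ))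
  · exact greedy_of_nonpos ((hlam δ).2 hδ)

theorem off_nonDecreasing (H : RelativeValue θ 1 g h) (hF : 0 < F θ) :
    NonDecreasingInAge (thresholdPolicy θ g h) false := by
  obtain ⟨lam, hlam⟩ := exists_threshold (P := fun δ => 0 < ch1Excess θ g h δ false)
    fun δ hδ => hδ.trans_le (H.excess_off_monotone hF δ)
  refine ⟨lam, fun δ _ => ⟨fun hδ => ?_, fun hδ => ?_⟩⟩ <;> rw [thresholdPolicy_off]
  · exact greedy_of_nonpos (not_lt.1 ((hlam δ).1 hδ))
  · exact greedy_of_pos ((hlam δ).2 hδ)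

/-- The policy is constant on the ages below d and from d on; with Channel 1 on the upper block,
either choice on the lower one is non-increasing. -/
theorem on_nonIncreasing (hd : ch1Excess θ g h θ.d true ≤ 0) :
    NonIncreasingInAge (thresholdPolicy θ g h) true := by
  obtain ⟨lam, hlam⟩ := exists_threshold
    (P := fun δ => thresholdPolicy θ g h ⟨δ, true, 0⟩ = Action.ch1) fun δ hδ => by
      rw [thresholdPolicy_on] at hδ ⊢
      split_ifs with h1
      · rwa [if_pos (by omega)] at hδ
      · exact greedy_of_nonpos hd
  refine ⟨lam, fun δ _ => ⟨fun hδ => ?_, (hlam δ).2⟩⟩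
  have hne := (hlam δ).1 hδ
  rw [thresholdPolicy_on] at hne ⊢
  split_ifs at hne ⊢
  · exact greedy_of_pos (not_le.1 fun hle => hne (greedy_of_nonpos hle))
  · exact absurd (greedy_of_nonpos hd) hne

theorem on_nonDecreasing (hmono : ch1Excess θ g h 1 true ≤ ch1Excess θ g h θ.d true) :
    NonDecreasingInAge (thresholdPolicy θ g h) true := by
  obtain ⟨lam, hlam⟩ := exists_threshold
    (P := fun δ => thresholdPolicy θ g h ⟨δ, true, 0⟩ = Action.ch2) fun δ hδ => by
      rw [thresholdPolicy_on] at hδ ⊢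
      split_ifs at hδ ⊢ with h1 h2 h2
      · exact hδ
      · omega
      · by_cases hle : ch1Excess θ g h 1 true ≤ 0
        · rw [greedy_of_nonpos hle] at hδ
          cases hδ
        · exact greedy_of_pos ((not_le.1 hle).trans_le hmono)
      · exact hδ
  refine ⟨lam, fun δ _ => ⟨fun hδ => ?_, (hlam δ).2⟩⟩
  have hne := (hlam δ).1 hδ
  rw [thresholdPolicy_on] at hne ⊢
  split_ifs at hne ⊢ <;>
    exact greedy_of_nonpos (not_lt.1 fun hlt => hne (greedy_of_pos hlt))

/-! ### Optimality of the threshold policy -/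

/-- The greedy action attains the optimality equation in an idle state. -/
theorem greedy_attains (H : RelativeValue θ 1 g h) (δ : ℕ) (l : Bool) :
    δ - g + nextMean θ h ⟨δ, l, 0⟩ (greedy θ g h δ l) = h ⟨δ, l, 0⟩ := by
  rw [H.idle_eq]
  by_cases hle : ch1Excess θ g h δ l ≤ 0
  · rw [greedy_of_nonpos hle, H.nextMean_ch1, min_eq_left (sub_nonpos.1 hle)]
  · rw [greedy_of_pos (not_le.1 hle), H.nextMean_ch2, min_eq_right (sub_pos.1 (not_le.1 hle)).le]

theorem busy_attains (H : RelativeValue θ 1 g h) {s : State} (hs : 1 ≤ s.l2) (u : Action) :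
    s.age - g + nextMean θ h s u = h s := by
  obtain ⟨δ, l, k⟩ := s
  rw [H.eqn, minMean, one_mul]
  rcases k with _ | _ | k
  · exact absurd hs (by simp)
  · simp [nextMean_busy_one]
  · simp [nextMean_busy_add_two]

theorem subsolution (H : RelativeValue θ 1 g h) (s : State) (u : Action) :
    h s ≤ s.age - g + nextMean θ h s u := by
  rcases Nat.eq_zero_or_pos s.l2 with hs | hs
  · obtain ⟨δ, l, k⟩ := s
    obtain rfl : k = 0 := hs
    rw [H.eqn, one_mul]
    refine add_le_add_right ?_ _
    cases u
    · exact min_le_left _ _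
    · exact min_le_right _ _
    -- Sending nothing differs from Channel 1 only if the channel is ON, and then leaves age δ + 1
    -- instead of 1.
    · refine (min_le_left _ _).trans ?_
      rw [nextMean_idle_ch1, nextMean_idle_none]
      refine add_le_add_left (mul_le_mul_of_nonneg_left ?_ (onProb_nonneg _ _)) _
      exact H.mono_age true 0 (Nat.le_add_left 1 δ)
  · exact (H.busy_attains hs u).ge

/-- Every state entered under the threshold policy is one where it is greedy. -/
theorem thresholdPolicy_attains_next (H : RelativeValue θ 1 g h) (s : State) (b : Bool) :
    ((nextState θ s (thresholdPolicy θ g h s) b).age : ℝ) - g +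
        nextMean θ h (nextState θ s (thresholdPolicy θ g h s) b)
          (thresholdPolicy θ g h (nextState θ s (thresholdPolicy θ g h s) b)) =
      h (nextState θ s (thresholdPolicy θ g h s) b) := by
  have hd := θ.two_le_d
  have hone : (1 : ℕ) - g + nextMean θ h ⟨1, true, 0⟩ (thresholdPolicy θ g h ⟨1, true, 0⟩) =
      h ⟨1, true, 0⟩ := by
    rw [thresholdPolicy_on, if_pos (by omega), H.greedy_attains]
  have hoff : ∀ δ : ℕ, δ - g + nextMean θ h ⟨δ, false, 0⟩
      (thresholdPolicy θ g h ⟨δ, false, 0⟩) = h ⟨δ, false, 0⟩ := fun δ => by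
    rw [thresholdPolicy_off, H.greedy_attains]
  have hond : θ.d - g + nextMean θ h ⟨θ.d, true, 0⟩
      (thresholdPolicy θ g h ⟨θ.d, true, 0⟩) = h ⟨θ.d, true, 0⟩ := by
    rw [thresholdPolicy_on, if_neg (by omega), H.greedy_attains]
  have hidle : ∀ δ l, thresholdPolicy θ g h ⟨δ, l, 0⟩ = Action.ch1 ∨
      thresholdPolicy θ g h ⟨δ, l, 0⟩ = Action.ch2 := by
    intro δ l
    unfold thresholdPolicy greedy
    split_ifs <;> simp_all
  obtain ⟨δ, l, k⟩ := s
  rcases k with _ | _ | k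
  · rcases hidle δ l with e | e <;> rw [e]
    · cases b
      · exact hoff _
      · exact hone
    · exact H.busy_attains (show 1 ≤ θ.d - 1 by omega) _
  · rw [thresholdPolicy_busy θ g h (s := ⟨δ, l, 0 + 1⟩) le_rfl]
    cases b
    · exact hoff _
    · exact hond
  · rw [thresholdPolicy_busy θ g h (s := ⟨δ, l, k + 1 + 1⟩) (by simp)]
    exact H.busy_attains (show 1 ≤ k + 1 by omega) _

/-- On the state space the relative values are bounded below, and grow at most linearly. -/
theorem exists_bound (H : RelativeValue θ 1 g h) :
    ∃ A B : ℝ, 0 ≤ A ∧ 0 < B ∧ ∀ s ∈ states θ, -A ≤ h s ∧ h s ≤ A + B * s.age := by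
  have hM := one_le_growth θ
  have hp : 0 < 1 - θ.p := sub_pos.2 θ.p_lt_one
  have hg := H.one_le
  have hd : (2 : ℝ) ≤ θ.d := by exact_mod_cast θ.two_le_d
  have hoff : ∀ δ : ℕ, h ⟨δ, false, 0⟩ ≤ (δ + growth θ) * (1 / (1 - θ.p)) := fun δ => by
    rw [mul_one_div]
    exact H.off_le zero_lt_one le_rfl δ
  have hm : 0 < 1 / (1 - θ.p) := one_div_pos.2 hp
  set m := 1 / (1 - θ.p)
  set φ : Bool → ℝ := fun b => h ⟨θ.d, b, 0⟩ with hφ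
  have hMm : 0 ≤ (1 + growth θ) * m := by positivity
  have hφ0 := abs_nonneg (φ true)
  have hφ1 := abs_nonneg (φ false)
  have hdg : 0 ≤ θ.d * g := by positivity
  have hh0 := abs_nonneg (h ⟨0, false, 0⟩)
  have hdd : (0 : ℝ) ≤ θ.d * θ.d := by positivity
  refine ⟨(1 + growth θ) * m + |h ⟨0, false, 0⟩| + (θ.d * g + θ.d * θ.d) +
    (|φ true| + (|φ true| + |φ false|)), 1 + m + θ.d, by positivity, by positivity, ?_⟩
  rintro ⟨δ, l, k⟩ ⟨hδ, hk⟩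
  have hδ1 : (1 : ℝ) ≤ δ := by exact_mod_cast hδ
  have hmδ : 0 ≤ m * δ := by positivity
  have hdδ : 0 ≤ θ.d * (δ : ℝ) := by positivity
  change 1 ≤ δ at hδ
  change k < θ.d at hk
  change _ ∧ _ ≤ _ + _ * (δ : ℝ)
  rcases k with _ | k
  · cases l
    · have e1 : h ⟨0, false, 0⟩ ≤ h ⟨δ, false, 0⟩ := H.mono_age false 0 (Nat.zero_le δ)
      have e2 := neg_abs_le (h ⟨0, false, 0⟩)
      have e3 := hoff δ
      constructor <;> linarith
    · have e1 : h ⟨1, true, 0⟩ ≤ h ⟨δ, true, 0⟩ := H.mono_age true 0 hδ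
      rw [H.base] at e1
      have e2 := H.on_le_ch1 δ
      have e3 := hoff (δ + 1)
      push_cast at e3
      have e4 : (1 - θ.q) * h ⟨δ + 1, false, 0⟩ ≤ (δ + 1 + growth θ) * m := by
        have e5 := mul_le_mul_of_nonneg_left e3 (sub_pos.2 θ.q_lt_one).le
        have e6 : (1 - θ.q) * ((δ + 1 + growth θ) * m) ≤ (δ + 1 + growth θ) * m :=
          mul_le_of_le_one_left (by positivity) (by linarith [θ.q_pos])
        linarith
      constructor <;> linarith
  · obtain ⟨η, hη0, hη1, hη⟩ := channelStep_iterate_mem θ φ (k + 1) l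
    have hk' : (k : ℝ) + 1 ≤ θ.d := by exact_mod_cast hk.le
    have hk0 : (0 : ℝ) ≤ k := Nat.cast_nonneg k
    have e1 : |η * (φ false - φ true)| ≤ |φ true| + |φ false| := by
      rw [abs_mul, abs_of_nonneg hη0]
      refine (mul_le_of_le_one_left (abs_nonneg _) hη1).trans ?_
      rw [add_comm]
      exact abs_sub _ _
    obtain ⟨e2, e3⟩ := abs_le.1 e1
    have e4 := neg_abs_le (φ true)
    have e5 := le_abs_self (φ true)
    have e6 : ((k : ℝ) + 1) * g ≤ θ.d * g := mul_le_mul_of_nonneg_right hk' (by linarith)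
    have e7 : ((k : ℝ) + 1) * δ ≤ θ.d * δ := mul_le_mul_of_nonneg_right hk' (by linarith)
    have e8 : ((k : ℝ) + 1) * k ≤ θ.d * θ.d :=
      mul_le_mul hk' (by linarith) hk0 (by linarith)
    have e9 : 0 ≤ ((k : ℝ) + 1) * k := by positivity
    have e10 : 0 ≤ ((k : ℝ) + 1) * δ := by positivity
    have e11 : 0 ≤ ((k : ℝ) + 1) * g := by positivity
    rw [H.busy_eq, ← hφ, hη]
    constructor <;> linarith

theorem nextMean_add_const (θ : Params) (v : State → ℝ) (c : ℝ) (s : State) (u : Action) :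
    nextMean θ (fun s => v s + c) s u = nextMean θ v s u + c := by
  unfold nextMean
  ring

theorem nextMean_congr {θ : Params} {v w : State → ℝ} {s : State} {u : Action}
    (hvw : ∀ b, v (nextState θ s u b) = w (nextState θ s u b)) :
    nextMean θ v s u = nextMean θ w s u := by
  rw [nextMean, hvw, hvw, nextMean]

theorem isOptimal (H : RelativeValue θ 1 g h) : IsOptimal θ (thresholdPolicy θ g h) := by
  obtain ⟨A, B, hA, hB, hAB⟩ := H.exists_bound
  set μ := thresholdPolicy θ g h
  refine isOptimal_of_verification θ (fun s hs => thresholdPolicy_busy θ g h hs)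
    (g := g) (A := A + A) (B := B) (by linarith [H.one_le]) (by linarith) hB
    -- `h` itself may fail as a supersolution at initial ON states where the policy is not greedy.
    -- The lookahead `k` agrees with `h + A` on every state entered, so its equation holds with
    -- equality everywhere. The shift by `A` ensures nonnegativity.
    (h := fun s => h s + A) (k := fun s => s.age - g + nextMean θ h s (μ s) + A)
    (fun s hs => by linarith [(hAB s hs).1]) (fun s hs => by linarith [(hAB s hs).2])
    (fun s _ u => ?_) (fun s hs => ?_) fun s _ => ?_
  · rw [nextMean_add_const]
    linarith [H.subsolution s u]
  · linarith [(hAB s hs).1, H.subsolution s (μ s)]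
  · have e := nextMean_congr (v := fun s => s.age - g + nextMean θ h s (μ s))
      (H.thresholdPolicy_attains_next s)
    rw [nextMean_add_const, e]
    linarith

end RelativeValue

end HeteroAoI

end

theorem theorem1 (θ : HeteroAoI.Params) :
    ∃ μ : HeteroAoI.State → HeteroAoI.Action,
      HeteroAoI.IsOptimal θ μ ∧
      (θ ∈ HeteroAoI.B₁ →
        HeteroAoI.NonIncreasingInAge μ false ∧ HeteroAoI.NonIncreasingInAge μ true) ∧
      (θ ∈ HeteroAoI.B₂ →
        HeteroAoI.NonDecreasingInAge μ false ∧ HeteroAoI.NonIncreasingInAge μ true) ∧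
      (θ ∈ HeteroAoI.B₃ →
        HeteroAoI.NonDecreasingInAge μ false ∧ HeteroAoI.NonDecreasingInAge μ true) ∧
      (θ ∈ HeteroAoI.B₄ →
        HeteroAoI.NonIncreasingInAge μ false ∧ HeteroAoI.NonDecreasingInAge μ true) := by
  obtain ⟨g, h, H⟩ := HeteroAoI.exists_relativeValue θ
  have hd : 1 ≤ θ.d := by have := θ.two_le_d; omega
  refine ⟨HeteroAoI.thresholdPolicy θ g h, H.isOptimal, fun hB => ?_, fun hB => ?_,
    fun hB => ?_, fun hB => ?_⟩
  · exact ⟨H.off_nonIncreasing hB.1,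
      HeteroAoI.RelativeValue.on_nonIncreasing (H.excess_on_nonpos_of_mem_B₁ hB)⟩
  · exact ⟨H.off_nonDecreasing hB.1,
      HeteroAoI.RelativeValue.on_nonIncreasing (H.excess_on_nonpos_of_mem_B₂ hB)⟩
  · exact ⟨H.off_nonDecreasing hB.1,
      HeteroAoI.RelativeValue.on_nonDecreasing (H.excess_on_monotone_of_mem_B₃ hB hd)⟩
  · exact ⟨H.off_nonIncreasing hB.1,
      HeteroAoI.RelativeValue.on_nonDecreasing (H.excess_on_monotone_of_mem_B₄ hB hd)⟩
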